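/- **Theorem (Blow-up by isolated mass group).** Let $c>0$, $k>0$, $\gamma\ge 1$, $P(\rho)=k^2\rho^\gamma$, and consider in $\mathbb{R}^3$ the relativistic Euler equations $$\hat\rho_t+\operatorname{div}(\tilde\rho u)=0,\qquad (\tilde\rho u)_t+\operatorname{div}(\tilde\rho\, u\otimes u)+\nabla P=0,\qquad (\rho,u)|_{t=0}=(\rho_0,u_0),$$ $$\hat\rho=\frac{\rho+P|u|^2/c^4}{1-|u|^2/c^2},\qquad \tilde\rho=\frac{\rho+P/c^2}{1-|u|^2/c^2}.$$ For $T>0$, a pair $(\rho,u)$ is called a *regular solution* in $[0,T]\times\mathbb{R}^3$ if it satisfies this problem (the equations in the sense of distributions, the initial condition pointwise) and on $[0,T]\times\mathbb{R}^3$: (A) $\rho\ge 0$ and $(\rho,u)\in C^1([0,T]\times\mathbb{R}^3)$; (B) $|u|<c$ and $\sqrt{P'(\rho)}<c$; (C) $u_t+u\cdot\nabla u=0$ whenever $\rho(t,x)=0$. The maximal existence time $T_m\in[0,\infty]$ is the supremum of all $T$ for which a regular solution in $[0,T]\times\mathbb{R}^3$ with data $(\rho_0,u_0)$ exists. Suppose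 that the initial data $(\rho_0,u_0)$ have an *isolated mass group* $(A_0,B_0)$, that is, $A_0,B_0\subset\mathbb{R}^3$ are connected bounded open sets with smooth boundary such that $\overline{A_0}\subset B_0\subseteq B_{R_0}$ for some $R_0>0$, where $B_{R_0}$ is the ball of radius $R_0$ centered at the origin; $\rho_0=0$ on $B_0\setminus A_0$; $\int_{A_0}\rho_0\,dx>0$; $u_0$ equals a constant vector $\bar u_0$ on $\partial A_0$; and $$\int_{A_0}\tilde\rho_0\,u_0\,dx=0,\qquad\text{where } \tilde\rho_0=\frac{\rho_0+P(\rho_0)/c^2}{1-|u_0|^2/c^2}.$$ Then $T_m<+\infty$. In particular, no regular solution with these data exists for all times. -/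

import Mathlib

noncomputable section

namespace RelEuler

open MeasureTheory Set
open scoped ContDiff ENNReal Topology

/-- Physical space, with the Euclidean norm. -/
abbrev E3 : Type := EuclideanSpace ℝ (Fin 3)

/-- The pressure law `P(ρ) = k² ρ^γ`. -/
def pressure (k γ : ℝ) (r : ℝ) : ℝ := k ^ 2 * r ^ γ

/-- `ρ̂ = (ρ + P |u|² / c⁴) / (1 - |u|² / c²)`, as a function of the values `r` of the
mass-energy density and `v` of the velocity. -/
def rhoHat (c k γ : ℝ) (r : ℝ) (v : E3) : ℝ :=
  (r + pressure k γ r * ‖v‖ ^ 2 / c ^ 4) / (1 - ‖v‖ ^ 2 / c ^ 2)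

/-- `ρ̃ = (ρ + P / c²) / (1 - |u|² / c²)`, as a function of the values `r` of the
mass-energy density and `v` of the velocity. -/
def rhoTilde (c k γ : ℝ) (r : ℝ) (v : E3) : ℝ :=
  (r + pressure k γ r / c ^ 2) / (1 - ‖v‖ ^ 2 / c ^ 2)

/-- The time derivative of a function on space-time. -/
def dt (φ : ℝ × E3 → ℝ) (z : ℝ × E3) : ℝ := fderiv ℝ φ z (1, 0)

/-- The spatial derivative `v · ∇φ` in the direction `v` of a function on space-time. -/
def dx (φ : ℝ × E3 → ℝ) (z : ℝ × E3) (v : E3) : ℝ := fderiv ℝ φ z (0, v)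

/-- Smooth test functions with compact support in `(0, T) × ℝ³`. -/
structure IsTestFunction (T : ℝ) (φ : ℝ × E3 → ℝ) : Prop where
  smooth : ContDiff ℝ ∞ φ
  compact : HasCompactSupport φ
  support : tsupport φ ⊆ Ioo 0 T ×ˢ univ

/-- The energy equation `ρ̂_t + div (ρ̃ u) = 0` in the sense of distributions on
`(0, T) × ℝ³`. -/
def WeakEnergy (c k γ T : ℝ) (ρ : ℝ → E3 → ℝ) (u : ℝ → E3 → E3) : Prop :=
  ∀ φ : ℝ × E3 → ℝ, IsTestFunction T φ →
    ∫ z : ℝ × E3,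
      (rhoHat c k γ (ρ z.1 z.2) (u z.1 z.2) * dt φ z
        + rhoTilde c k γ (ρ z.1 z.2) (u z.1 z.2) * dx φ z (u z.1 z.2)) = 0

/-- The momentum equation `(ρ̃ u)_t + div (ρ̃ u ⊗ u) + ∇P = 0`, component by component, in the
sense of distributions on `(0, T) × ℝ³`. -/
def WeakMomentum (c k γ T : ℝ) (ρ : ℝ → E3 → ℝ) (u : ℝ → E3 → E3) : Prop :=
  ∀ φ : ℝ × E3 → ℝ, IsTestFunction T φ → ∀ i : Fin 3,
    ∫ z : ℝ × E3,
      (rhoTilde c k γ (ρ z.1 z.2) (u z.1 z.2) * u z.1 z.2 i * dt φ z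
        + rhoTilde c k γ (ρ z.1 z.2) (u z.1 z.2) * u z.1 z.2 i * dx φ z (u z.1 z.2)
        + pressure k γ (ρ z.1 z.2) * dx φ z (EuclideanSpace.single i 1)) = 0

/-- `(ρ, u)` is a regular solution in `[0, T] × ℝ³` of the Cauchy problem with data `(ρ₀, u₀)`.
The values of `ρ t` and `u t` for `t` outside `[0, T]` are irrelevant; derivatives in time at the
endpoints are one-sided. -/
structure IsRegularSolution (c k γ : ℝ) (ρ₀ : E3 → ℝ) (u₀ : E3 → E3) (T : ℝ)
    (ρ : ℝ → E3 → ℝ) (u : ℝ → E3 → E3) : Prop where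
  pos_time : 0 < T
  weak_energy : WeakEnergy c k γ T ρ u
  weak_momentum : WeakMomentum c k γ T ρ u
  init_density : ∀ x, ρ 0 x = ρ₀ x
  init_velocity : ∀ x, u 0 x = u₀ x
  density_nonneg : ∀ t ∈ Icc 0 T, ∀ x, 0 ≤ ρ t x
  density_c1 : ContDiffOn ℝ 1 (fun z : ℝ × E3 => ρ z.1 z.2) (Icc 0 T ×ˢ univ)
  velocity_c1 : ContDiffOn ℝ 1 (fun z : ℝ × E3 => u z.1 z.2) (Icc 0 T ×ˢ univ)
  subluminal : ∀ t ∈ Icc 0 T, ∀ x, ‖u t x‖ < c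
  sound_speed : ∀ t ∈ Icc 0 T, ∀ x, Real.sqrt (deriv (pressure k γ) (ρ t x)) < c
  vacuum_eq : ∀ t ∈ Icc 0 T, ∀ x, ρ t x = 0 →
    derivWithin (fun s => u s x) (Icc 0 T) t + fderiv ℝ (u t) x (u t x) = 0

/-- The maximal existence time `T_m ∈ [0, ∞]`: the supremum of all `T` such that a regular
solution with data `(ρ₀, u₀)` exists in `[0, T] × ℝ³`. -/
def maximalTime (c k γ : ℝ) (ρ₀ : E3 → ℝ) (u₀ : E3 → E3) : ℝ≥0∞ :=
  sSup {τ | ∃ T : ℝ, τ = ENNReal.ofReal T ∧ ∃ ρ u, IsRegularSolution c k γ ρ₀ u₀ T ρ u}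

/-- An open set has smooth boundary if near each boundary point it is the sublevel set
`{φ < 0}` of a smooth function `φ` whose differential does not vanish there. -/
def HasSmoothBoundary (A : Set E3) : Prop :=
  ∀ p ∈ frontier A, ∃ φ : E3 → ℝ, ContDiff ℝ ∞ φ ∧ fderiv ℝ φ p ≠ 0 ∧
    ∀ᶠ x in 𝓝 p, (x ∈ A ↔ φ x < 0)

/-- The data `(ρ₀, u₀)` have the isolated mass group `(A₀, B₀)`. Boundedness of both sets is
contained in `A₀ ⊆ closure A₀ ⊆ B₀ ⊆ B_{R₀}`. -/
structure IsIsolatedMassGroup (c k γ : ℝ) (ρ₀ : E3 → ℝ) (u₀ : E3 → E3)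
    (A₀ B₀ : Set E3) : Prop where
  isOpen_A : IsOpen A₀
  isOpen_B : IsOpen B₀
  connected_A : IsConnected A₀
  connected_B : IsConnected B₀
  smooth_A : HasSmoothBoundary A₀
  smooth_B : HasSmoothBoundary B₀
  closure_subset : closure A₀ ⊆ B₀
  bounded : ∃ R₀ : ℝ, 0 < R₀ ∧ B₀ ⊆ Metric.ball 0 R₀
  vacuum : ∀ x ∈ B₀ \ A₀, ρ₀ x = 0
  mass_pos : 0 < ∫ x in A₀, ρ₀ x
  velocity_const : ∃ ubar : E3, ∀ x ∈ frontier A₀, u₀ x = ubar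
  momentum_zero : ∫ x in A₀, rhoTilde c k γ (ρ₀ x) (u₀ x) • u₀ x = 0

end RelEuler

end

noncomputable section

namespace RelEuler

open MeasureTheory Set
open scoped ContDiff ENNReal Topology

/-! ### General lemmas from analysis -/

section General

/-! The proof is a virial argument in the frame moving with the common boundary velocity `w` of the
group.

Confinement. Eliminating time derivatives between the energy and momentum balances gives a linear
equation for `ρ` along particle paths (`density_transport_of_balance`), so paths that start in
vacuum stay in vacuum. There the velocity is transported, so the boundary particles of `A₀` move on
the straight lines `x + t w`. Two-sided Grönwall bounds prevent other paths from crossing them, and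
a uniform layer outside `A₀ + t w` remains vacuum up to time `T` (`exists_vacuum_annulus`).

Virial identity. Moments of `ρ̂` and `ρ̃ u` over `A₀ + t w` therefore evolve without boundary terms
(`IsBalanceLaw.hasDerivAt_movingMoment`). The energy `E` is conserved and the momentum remains zero,
so `N(t) = ∫_{A₀} ρ̂(t, y + t w) |y|² dy` satisfies `N'' = 2 ∫ (ρ̃ |u|² + 3P) + 2 |w|² E`.

Contradiction. Since `ρ̂ = ρ + ρ̃ |u|²/c²`, the first integrand is at least `μ (ρ̂ - l)` with `μ =
min (c², k² l^(γ-1))` for every `l > 0` (`mul_rhoHat_sub_le`). Taking `l = E / (2 |A₀|)` gives `N''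
≥ μ E > 0`, while `0 ≤ N ≤ R² E` by confinement. Convexity then bounds `T` by data alone
(`mul_sq_le_of_second_deriv_ge`). -/

lemma exists_mem_frontier_of_isPreconnected {X : Type*} [TopologicalSpace X] {S A : Set X}
    (hS : IsPreconnected S) (hA : IsOpen A) (h₁ : (S ∩ A).Nonempty) (h₂ : (S ∩ Aᶜ).Nonempty) :
    (S ∩ frontier A).Nonempty := by
  by_contra h
  have hfr : ∀ x ∈ S, x ∉ frontier A := fun x hx hxA => h ⟨x, hx, hxA⟩
  have hcl : ∀ x ∈ S, x ∉ A → x ∉ closure A := fun x hx hxA hxc =>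
    hfr x hx ⟨hxc, fun hi => hxA (interior_subset hi)⟩
  obtain ⟨y, hyS, hyA⟩ := h₂
  -- If `S` missed the frontier, `A` and the complement of its closure would be disjoint open sets
  -- separating `S`.
  obtain ⟨z, -, hzA, hz⟩ := hS A (closure A)ᶜ hA isClosed_closure.isOpen_compl
    (fun x hx => by
      by_cases hxA : x ∈ A
      · exact Or.inl hxA
      · exact Or.inr (hcl x hx hxA)) h₁ ⟨y, hyS, hcl y hyS hyA⟩
  exact hz (subset_closure hzA)

/-- Two-sided Grönwall estimate: if `‖f'‖ ≤ K ‖f‖` then `f` grows at most exponentially, both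
forwards and backwards in time. -/
lemma norm_le_exp_mul_norm {F : Type*} [NormedAddCommGroup F] [InnerProductSpace ℝ F]
    {T K : ℝ} (hK : 0 ≤ K) {f f' : ℝ → F} (hf : ContinuousOn f (Icc 0 T))
    (hf' : ∀ s ∈ Ioo 0 T, HasDerivAt f (f' s) s) (hb : ∀ s ∈ Ioo 0 T, ‖f' s‖ ≤ K * ‖f s‖)
    {s t : ℝ} (hs : s ∈ Icc 0 T) (ht : t ∈ Icc 0 T) :
    ‖f t‖ ≤ Real.exp (K * T) * ‖f s‖ := by
  -- The square of the norm is differentiable even where `f` vanishes. The choices `σ = 2K` and `σ =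
  -- -2K` give a monotone and an antitone function, one for each direction of time.
  have hder : ∀ (σ : ℝ), ∀ x ∈ Ioo 0 T, HasDerivAt (fun s => Real.exp (σ * s) * ‖f s‖ ^ 2)
      (Real.exp (σ * x) * (σ * ‖f x‖ ^ 2 + 2 * inner ℝ (f x) (f' x))) x := by
    intro σ x hx
    have h1 : HasDerivAt (fun s : ℝ => Real.exp (σ * s)) (Real.exp (σ * x) * (σ * 1)) x :=
      ((hasDerivAt_id x).const_mul σ).exp
    refine (h1.mul (hf' x hx).norm_sq).congr_deriv ?_
    ring
  have hcont : ∀ σ : ℝ, ContinuousOn (fun s => Real.exp (σ * s) * ‖f s‖ ^ 2) (Icc 0 T) := by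
    intro σ
    exact (by fun_prop : Continuous fun s : ℝ => Real.exp (σ * s)).continuousOn.mul
      (hf.norm.pow 2)
  have hin : ∀ x ∈ Ioo 0 T, |inner ℝ (f x) (f' x)| ≤ K * ‖f x‖ ^ 2 := by
    intro x hx
    calc |inner ℝ (f x) (f' x)| ≤ ‖f x‖ * ‖f' x‖ := abs_real_inner_le_norm _ _
      _ ≤ ‖f x‖ * (K * ‖f x‖) := by gcongr; exact hb x hx
      _ = K * ‖f x‖ ^ 2 := by ring
  have hmono : MonotoneOn (fun s => Real.exp ((2 * K) * s) * ‖f s‖ ^ 2) (Icc 0 T) := by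
    refine monotoneOn_of_deriv_nonneg (convex_Icc 0 T) (hcont _) ?_ ?_
    · rw [interior_Icc]
      exact fun x hx => (hder _ x hx).differentiableAt.differentiableWithinAt
    · rw [interior_Icc]
      intro x hx
      rw [(hder _ x hx).deriv]
      have := abs_le.1 (hin x hx)
      exact mul_nonneg (Real.exp_nonneg _) (by linarith [this.1])
  have hanti : AntitoneOn (fun s => Real.exp (-(2 * K) * s) * ‖f s‖ ^ 2) (Icc 0 T) := by
    refine antitoneOn_of_deriv_nonpos (convex_Icc 0 T) (hcont _) ?_ ?_
    · rw [interior_Icc]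
      exact fun x hx => (hder _ x hx).differentiableAt.differentiableWithinAt
    · rw [interior_Icc]
      intro x hx
      rw [(hder _ x hx).deriv]
      have := abs_le.1 (hin x hx)
      exact mul_nonpos_of_nonneg_of_nonpos (Real.exp_nonneg _) (by linarith [this.2])
  have key : ‖f t‖ ^ 2 ≤ (Real.exp (K * T) * ‖f s‖) ^ 2 := by
    have hexp : (Real.exp (K * T) * ‖f s‖) ^ 2 = Real.exp (2 * K * T) * ‖f s‖ ^ 2 := by
      rw [mul_pow, ← Real.exp_nat_mul]; congr 2; push_cast; ring
    rw [hexp]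
    rcases le_total s t with h | h
    · have h1 : Real.exp (-(2 * K) * t) * ‖f t‖ ^ 2 ≤ Real.exp (-(2 * K) * s) * ‖f s‖ ^ 2 :=
        hanti hs ht h
      have h2 := mul_le_mul_of_nonneg_left h1 (Real.exp_nonneg (2 * K * t))
      rw [← mul_assoc, ← mul_assoc, ← Real.exp_add, ← Real.exp_add] at h2
      rw [show 2 * K * t + -(2 * K) * t = 0 by ring, Real.exp_zero, one_mul] at h2
      refine h2.trans ?_
      gcongr
      nlinarith [hs.1, ht.2]
    · have h1 : Real.exp ((2 * K) * t) * ‖f t‖ ^ 2 ≤ Real.exp ((2 * K) * s) * ‖f s‖ ^ 2 :=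
        hmono ht hs h
      have h2 := mul_le_mul_of_nonneg_left h1 (Real.exp_nonneg (-(2 * K * t)))
      rw [← mul_assoc, ← mul_assoc, ← Real.exp_add, ← Real.exp_add] at h2
      rw [show -(2 * K * t) + 2 * K * t = 0 by ring, Real.exp_zero, one_mul] at h2
      refine h2.trans ?_
      gcongr
      nlinarith [hs.2, ht.1]
  exact le_of_sq_le_sq key (by positivity)

/-- Off the support of `φ` the product vanishes locally, so the behaviour of `f` outside `Ω` does
not matter. -/
lemma continuous_mul_of_tsupport_subset {X : Type*} [TopologicalSpace X] {Ω : Set X} (hΩ : IsOpen Ω) {f φ : X → ℝ}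
    (hf : ContinuousOn f Ω) (hφ : Continuous φ) (hs : tsupport φ ⊆ Ω) :
    Continuous fun x => f x * φ x := by
  rw [continuous_iff_continuousAt]
  intro x
  by_cases hx : x ∈ tsupport φ
  · exact (hf.continuousAt (hΩ.mem_nhds (hs hx))).mul hφ.continuousAt
  · have h0 : (fun x => f x * φ x) =ᶠ[𝓝 x] fun _ => 0 := by
      filter_upwards [(isClosed_tsupport φ).isOpen_compl.mem_nhds hx] with y hy
      rw [image_eq_zero_of_notMem_tsupport hy, mul_zero]
    exact continuousAt_const.congr h0.symm

lemma integrable_mul_of_tsupport_subset {X : Type*} [NormedAddCommGroup X]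
    [MeasurableSpace X] [BorelSpace X] {μ : Measure X} [IsFiniteMeasureOnCompacts μ] {Ω : Set X} (hΩ : IsOpen Ω) {f φ : X → ℝ}
    (hf : ContinuousOn f Ω) (hφ : Continuous φ) (hc : HasCompactSupport φ)
    (hs : tsupport φ ⊆ Ω) : Integrable (fun x => f x * φ x) μ :=
  (continuous_mul_of_tsupport_subset hΩ hf hφ hs).integrable_of_hasCompactSupport hc.mul_left

variable {X : Type*} [NormedAddCommGroup X] [NormedSpace ℝ X]

lemma continuousOn_fderiv_apply {F : Type*} [NormedAddCommGroup F] [NormedSpace ℝ F]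
    {Ω : Set X} (hΩ : IsOpen Ω) {f : X → F} (hf : ContDiffOn ℝ 1 f Ω) (v : X) :
    ContinuousOn (fun x => fderiv ℝ f x v) Ω :=
  (hf.continuousOn_fderiv_of_isOpen hΩ le_rfl).clm_apply continuousOn_const

/-- A smooth cutoff which is `1` on a closed set and supported in a neighbourhood. -/
lemma exists_contDiff_cutoff [FiniteDimensional ℝ X] {S N : Set X} (hS : IsClosed S) (hN : IsOpen N) (hSN : S ⊆ N) :
    ∃ χ : X → ℝ, ContDiff ℝ 1 χ ∧ tsupport χ ⊆ N ∧ ∀ x ∈ S, χ x = 1 := by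
  obtain ⟨f, h0, h1, -⟩ := exists_contMDiffMap_zero_one_nhds_of_isClosed
    (modelWithCornersSelf ℝ X) (n := (1 : ℕ∞)) hN.isClosed_compl hS
    (disjoint_left.2 fun x hx hxS => hx (hSN hxS))
  refine ⟨f, f.contMDiff.contDiff, fun x hx => ?_, fun x hx => h1.self_of_nhdsSet x hx⟩
  by_contra hxN
  have h2 : ∀ᶠ y in 𝓝 x, f y = 0 := Filter.Eventually.filter_mono (nhds_le_nhdsSet hxN) h0
  exact notMem_tsupport_iff_eventuallyEq.2 h2 hx

variable [MeasurableSpace X] [BorelSpace X] {μ : Measure X}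
  [FiniteDimensional ℝ X] [μ.IsAddHaarMeasure]

/-- Integration by parts against a compactly supported test function. -/
lemma integral_mul_fderiv_test {Ω : Set X} (hΩ : IsOpen Ω) {f φ : X → ℝ}
    (hf : ContDiffOn ℝ 1 f Ω) (hφ : ContDiff ℝ 1 φ) (hc : HasCompactSupport φ)
    (hs : tsupport φ ⊆ Ω) (v : X) :
    Integrable (fun x => f x * fderiv ℝ φ x v) μ ∧
    ∫ x, f x * fderiv ℝ φ x v ∂μ = - ∫ x, fderiv ℝ f x v * φ x ∂μ := by
  have hφ' : Continuous fun x => fderiv ℝ φ x v :=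
    (hφ.continuous_fderiv one_ne_zero).clm_apply continuous_const
  have hint : Integrable (fun x => f x * fderiv ℝ φ x v) μ :=
    integrable_mul_of_tsupport_subset hΩ hf.continuousOn hφ' (hc.fderiv_apply ℝ v)
      ((tsupport_fderiv_apply_subset ℝ v).trans hs)
  refine ⟨hint, ?_⟩
  refine integral_mul_fderiv_eq_neg_fderiv_mul_of_integrable
    (integrable_mul_of_tsupport_subset hΩ (continuousOn_fderiv_apply hΩ hf v) hφ.continuous hc hs)
    hint
    (integrable_mul_of_tsupport_subset hΩ hf.continuousOn hφ.continuous hc hs)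
    (fun x hx => ((hf.differentiableOn one_ne_zero) x (hs hx)).differentiableAt
      (hΩ.mem_nhds (hs hx)))
    (fun x _ => (hφ.differentiable one_ne_zero) x)

/-- A `C¹` vector field whose divergence vanishes in the sense of distributions is divergence
free pointwise. -/
lemma sum_fderiv_eq_zero_of_weak {ι : Type*} [Fintype ι] {Ω : Set X} (hΩ : IsOpen Ω)
    {a : ι → X → ℝ} {v : ι → X} (ha : ∀ j, ContDiffOn ℝ 1 (a j) Ω)
    (h : ∀ φ : X → ℝ, ContDiff ℝ ∞ φ → HasCompactSupport φ → tsupport φ ⊆ Ω →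
      ∫ x, ∑ j, a j x * fderiv ℝ φ x (v j) ∂μ = 0) :
    ∀ x ∈ Ω, ∑ j, fderiv ℝ (a j) x (v j) = 0 := by
  have hcont : ContinuousOn (fun x => ∑ j, fderiv ℝ (a j) x (v j)) Ω :=
    continuousOn_finsetSum _ fun j _ => continuousOn_fderiv_apply hΩ (ha j) (v j)
  -- After integration by parts the divergence is orthogonal to all test functions, hence zero
  -- almost everywhere; continuity then removes the exceptional set.
  have hae : ∀ᵐ x ∂μ, x ∈ Ω → ∑ j, fderiv ℝ (a j) x (v j) = 0 := by
    refine hΩ.ae_eq_zero_of_integral_contDiff_smul_eq_zero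
      (hcont.locallyIntegrableOn hΩ.measurableSet) ?_
    intro φ hφ hc hs
    have h1 := h φ hφ hc hs
    have hφ1 : ContDiff ℝ 1 φ := hφ.of_le (by exact_mod_cast le_top)
    have hp := fun j => integral_mul_fderiv_test (μ := μ) hΩ (ha j) hφ1 hc hs (v j)
    rw [integral_finsetSum _ fun j _ => (hp j).1] at h1
    simp_rw [fun j => (hp j).2, Finset.sum_neg_distrib] at h1
    rw [← integral_finsetSum _ fun j _ => integrable_mul_of_tsupport_subset hΩ
      (continuousOn_fderiv_apply hΩ (ha j) (v j)) hφ1.continuous hc hs] at h1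
    rw [← neg_eq_zero, ← h1]
    congr 2
    ext x
    rw [smul_eq_mul, Finset.mul_sum]
    exact Finset.sum_congr rfl fun j _ => mul_comm _ _
  have hr : (fun x => ∑ j, fderiv ℝ (a j) x (v j)) =ᵐ[μ.restrict Ω] fun _ => (0 : ℝ) :=
    (ae_restrict_iff' hΩ.measurableSet).2 hae
  exact Measure.eqOn_open_of_ae_eq hr hΩ hcont continuousOn_const

/-- Evolution of the weighted spatial integral of a `C¹` density obeying a conservation law. -/
lemma hasDerivAt_integral_mul_of_conservation {ι : Type*} [Fintype ι] {T : ℝ} {b : ℝ × X → ℝ}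
    {a : ι → ℝ × X → ℝ} {e : ι → X} (hb : ContDiffOn ℝ 1 b (Ioo 0 T ×ˢ univ))
    (ha : ∀ j, ContDiffOn ℝ 1 (a j) (Ioo 0 T ×ˢ univ))
    (heq : ∀ z ∈ Ioo 0 T ×ˢ (univ : Set X),
      fderiv ℝ b z (1, 0) + ∑ j, fderiv ℝ (a j) z (0, e j) = 0)
    {ψ : X → ℝ} (hψ : ContDiff ℝ 1 ψ) (hc : HasCompactSupport ψ) {t : ℝ} (ht : t ∈ Ioo 0 T) :
    HasDerivAt (fun s => ∫ y, b (s, y) * ψ y ∂μ)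
      (∑ j, ∫ y, a j (t, y) * fderiv ℝ ψ y (e j) ∂μ) t := by
  have hΩ : IsOpen (Ioo 0 T ×ˢ (univ : Set X)) := isOpen_Ioo.prod isOpen_univ
  have hmem : ∀ {s : ℝ}, s ∈ Ioo 0 T → ∀ y : X, (s, y) ∈ Ioo 0 T ×ˢ (univ : Set X) :=
    fun hs y => ⟨hs, mem_univ y⟩
  have hslice : ∀ {f : ℝ × X → ℝ}, ContinuousOn f (Ioo 0 T ×ˢ univ) → ∀ {s : ℝ}, s ∈ Ioo 0 T →
      Continuous fun y => f (s, y) := fun hf s hs =>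
    hf.comp_continuous (by fun_prop) fun y => hmem hs y
  have hint : ∀ {f : X → ℝ}, Continuous f → Integrable (fun y => f y * ψ y) μ := fun hf =>
    integrable_mul_of_tsupport_subset isOpen_univ hf.continuousOn hψ.continuous hc (subset_univ _)
  have hbt := continuousOn_fderiv_apply hΩ hb (1, 0)
  -- A compact time window around `t` makes the time derivative bounded on the support of `ψ`, which
  -- supplies the dominating function.
  obtain ⟨t₁, t₂, htt, hsub⟩ : ∃ t₁ t₂, t ∈ Ioo t₁ t₂ ∧ Icc t₁ t₂ ⊆ Ioo 0 T :=
    ⟨t / 2, (t + T) / 2, ⟨by linarith [ht.1], by linarith [ht.2]⟩, fun s hs =>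
      ⟨by linarith [hs.1, ht.1], by linarith [hs.2, ht.2]⟩⟩
  obtain ⟨C, hC⟩ := (isCompact_Icc.prod hc.isCompact).exists_bound_of_continuousOn
    (hbt.mono (prod_mono hsub (subset_univ _)))
  have hdb : ∀ s ∈ Ioo 0 T, ∀ y, HasDerivAt (fun s => b (s, y)) (fderiv ℝ b (s, y) (1, 0)) s := by
    intro s hs y
    have h1 := ((hb.differentiableOn one_ne_zero) _ (hmem hs y)).differentiableAt
      (hΩ.mem_nhds (hmem hs y)) |>.hasFDerivAt
    exact h1.comp_hasDerivAt (f := fun s : ℝ => (s, y)) s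
      ((hasDerivAt_id s).prodMk (hasDerivAt_const s y))
  have key := hasDerivAt_integral_of_dominated_loc_of_deriv_le (μ := μ)
    (F := fun s y => b (s, y) * ψ y) (F' := fun s y => fderiv ℝ b (s, y) (1, 0) * ψ y)
    (bound := fun y => C * ‖ψ y‖) (x₀ := t) (s := Ioo t₁ t₂) (Ioo_mem_nhds htt.1 htt.2)
    (by
      filter_upwards [Ioo_mem_nhds ht.1 ht.2] with s hs
      exact (hint (hslice hb.continuousOn hs)).aestronglyMeasurable)
    (hint (hslice hb.continuousOn ht))
    (hint (hslice hbt ht)).aestronglyMeasurable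
    (by
      refine Filter.Eventually.of_forall fun y s hs => ?_
      rw [norm_mul]
      by_cases hy : y ∈ tsupport ψ
      · exact mul_le_mul_of_nonneg_right (hC (s, y) ⟨Ioo_subset_Icc_self hs, hy⟩) (norm_nonneg _)
      · simp [image_eq_zero_of_notMem_tsupport hy])
    ((hψ.continuous.norm.integrable_of_hasCompactSupport hc.norm).const_mul C)
    (Filter.Eventually.of_forall fun y s hs =>
      (hdb s (hsub (Ioo_subset_Icc_self hs)) y).mul_const _)
  refine key.2.congr_deriv ?_
  have hcont : ∀ j, ContDiff ℝ 1 fun y => a j (t, y) := fun j =>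
    (ha j).comp_contDiff (contDiff_const.prodMk contDiff_id) fun y => hmem ht y
  have hsp : ∀ j y, fderiv ℝ (fun y => a j (t, y)) y (e j) = fderiv ℝ (a j) (t, y) (0, e j) := by
    intro j y
    have h1 := (((ha j).differentiableOn one_ne_zero) _ (hmem ht y)).differentiableAt
      (hΩ.mem_nhds (hmem ht y)) |>.hasFDerivAt
    have h2 : HasFDerivAt (fun y => a j (t, y)) _ y :=
      h1.comp y ((hasFDerivAt_const t y).prodMk (hasFDerivAt_id y))
    rw [h2.fderiv]
    simp
  have hparts := fun j => (integral_mul_fderiv_test (μ := μ) isOpen_univ (hcont j).contDiffOn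
    hψ hc (subset_univ _) (e j)).2
  simp_rw [hparts, hsp, Finset.sum_neg_distrib]
  rw [← integral_finsetSum _ fun j _ =>
    hint (hslice (continuousOn_fderiv_apply hΩ (ha j) (0, e j)) ht), ← integral_neg]
  congr 1
  ext y
  rw [← Finset.sum_mul, ← neg_mul, eq_neg_of_add_eq_zero_left (heq (t, y) (hmem ht y))]

/-- Evolution of the weighted integral over an isolated group: the density and the fluxes vanish
on a neighbourhood of `A` outside of `A`, so that no boundary terms appear. -/
lemma hasDerivAt_setIntegral_of_conservation {ι : Type*} [Fintype ι] {T : ℝ} {b : ℝ × X → ℝ}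
    {a : ι → ℝ × X → ℝ} {e : ι → X} (hb : ContDiffOn ℝ 1 b (Ioo 0 T ×ˢ univ))
    (ha : ∀ j, ContDiffOn ℝ 1 (a j) (Ioo 0 T ×ˢ univ))
    (heq : ∀ z ∈ Ioo 0 T ×ˢ (univ : Set X),
      fderiv ℝ b z (1, 0) + ∑ j, fderiv ℝ (a j) z (0, e j) = 0)
    {A N : Set X} (hA : IsOpen A) (hN : IsOpen N) (hNb : Bornology.IsBounded N)
    (hAN : closure A ⊆ N) (hb0 : ∀ s ∈ Ioo 0 T, ∀ y ∈ N \ A, b (s, y) = 0)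
    (ha0 : ∀ j, ∀ s ∈ Ioo 0 T, ∀ y ∈ N \ A, a j (s, y) = 0)
    {q : X → ℝ} (hq : ContDiff ℝ 1 q) {t : ℝ} (ht : t ∈ Ioo 0 T) :
    HasDerivAt (fun s => ∫ y in A, b (s, y) * q y ∂μ)
      (∑ j, ∫ y in A, a j (t, y) * fderiv ℝ q y (e j) ∂μ) t := by
  -- Replacing `q` by `χ q` makes the weight compactly supported. The transition region of `χ` lies
  -- in `N \ A`, where density and fluxes vanish, so no integral changes.
  obtain ⟨χ, hχ, hsupp, hχ1⟩ := exists_contDiff_cutoff isClosed_closure hN hAN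
  have hχc : HasCompactSupport χ :=
    Metric.isCompact_of_isClosed_isBounded (isClosed_tsupport χ) (hNb.subset hsupp)
  have hψs : tsupport (fun y => χ y * q y) ⊆ N := (tsupport_mul_subset_left).trans hsupp
  have hψ : ∀ y ∈ A, χ y * q y = q y := fun y hy => by rw [hχ1 y (subset_closure hy), one_mul]
  have key := hasDerivAt_integral_mul_of_conservation (μ := μ) hb ha heq (hχ.mul hq)
    (hχc.mul_right) ht
  have hval : ∀ {f g h : X → ℝ}, (∀ y ∈ N \ A, f y = 0) → (∀ y ∉ N, g y = 0) →
      (∀ y ∈ A, g y = h y) → ∫ y, f y * g y ∂μ = ∫ y in A, f y * h y ∂μ := by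
    intro f g h hf hg hgh
    rw [← integral_indicator hA.measurableSet]
    congr 1
    ext y
    by_cases hy : y ∈ A
    · rw [indicator_of_mem hy, hgh y hy]
    · rw [indicator_of_notMem hy]
      by_cases hyN : y ∈ N
      · rw [hf y ⟨hyN, hy⟩, zero_mul]
      · rw [hg y hyN, mul_zero]
  have hsum : (∑ j, ∫ y, a j (t, y) * fderiv ℝ (fun y => χ y * q y) y (e j) ∂μ)
      = ∑ j, ∫ y in A, a j (t, y) * fderiv ℝ q y (e j) ∂μ := by
    refine Finset.sum_congr rfl fun j _ => hval (ha0 j t ht) (fun y hy => ?_) (fun y hy => ?_)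
    · exact image_eq_zero_of_notMem_tsupport
        (f := fun x => fderiv ℝ (fun y => χ y * q y) x (e j)) fun h => hy (hψs (tsupport_fderiv_apply_subset ℝ (e j) h))
    · have : (fun y => χ y * q y) =ᶠ[𝓝 y] q := by
        filter_upwards [hA.mem_nhds hy] with x hx using hψ x hx
      rw [this.fderiv_eq]
  rw [← hsum]
  refine key.congr_of_eventuallyEq ?_
  filter_upwards [Ioo_mem_nhds ht.1 ht.2] with s hs
  exact (hval (hb0 s hs) (fun y hy => image_eq_zero_of_notMem_tsupport fun h => hy (hψs h))
    hψ).symm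

end General

/-! ### The equations in pointwise form -/

/-- The `i`-th standard basis vector of physical space. -/
abbrev basisVec (i : Fin 3) : E3 := EuclideanSpace.single i 1

lemma sum_smul_basisVec (v : E3) : ∑ j, v j • basisVec j = v := by
  ext i
  simp [basisVec, Fin.sum_univ_three]
  fin_cases i <;> simp

lemma map_eq_sum_basisVec (L : ℝ × E3 →L[ℝ] ℝ) (v : E3) :
    L (0, v) = ∑ j, v j * L (0, basisVec j) := by
  have h : ((0 : ℝ), v) = ∑ j, v j • ((0 : ℝ), basisVec j) := by
    have : ∑ j, v j • ((0 : ℝ), basisVec j) = (0, ∑ j, v j • basisVec j) := by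
      rw [Prod.ext_iff]
      simp [Prod.fst_sum, Prod.snd_sum]
    rw [this, sum_smul_basisVec]
  rw [h, map_sum]
  exact Finset.sum_congr rfl fun j _ => by rw [map_smul, smul_eq_mul]

lemma map_eq_time_add_sum (L : ℝ × E3 →L[ℝ] ℝ) (v : E3) :
    L (1, v) = L (1, 0) + ∑ j, v j * L (0, basisVec j) := by
  rw [← map_eq_sum_basisVec, ← map_add]
  simp

lemma norm_sq_eq_sum (v : E3) : ‖v‖ ^ 2 = ∑ i, v i ^ 2 := by
  simp [EuclideanSpace.norm_sq_eq]

instance : (volume : Measure (ℝ × E3)).IsAddHaarMeasure :=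
  inferInstanceAs ((volume : Measure ℝ).prod (volume : Measure E3)).IsAddHaarMeasure

/-- The transport equation for the density, obtained by eliminating the time derivative of the
relativistic mass from the energy and momentum balances. -/
lemma density_transport_of_balance {κ : ℝ} {R p m H : ℝ × E3 → ℝ} {U : Fin 3 → ℝ × E3 → ℝ}
    {z : ℝ × E3} (hR : DifferentiableAt ℝ R z) (hp : DifferentiableAt ℝ p z)
    (hm : DifferentiableAt ℝ m z) (hU : ∀ i, DifferentiableAt ℝ (U i) z)
    (hH : H =ᶠ[𝓝 z] fun z => m z - κ * p z)
    (hcon : (fun z => m z * (1 - κ * ∑ i, U i z ^ 2)) =ᶠ[𝓝 z] fun z => R z + κ * p z)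
    (henergy : fderiv ℝ H z (1, 0) + ∑ j, fderiv ℝ (fun z => m z * U j z) z (0, basisVec j) = 0)
    (hmom : ∀ i, fderiv ℝ (fun z => m z * U i z) z (1, 0)
      + ∑ j, fderiv ℝ (fun z => m z * U i z * U j z + if j = i then p z else 0) z
        (0, basisVec j) = 0) :
    fderiv ℝ R z (1, 0) + ∑ j, U j z * fderiv ℝ R z (0, basisVec j) =
      -m z * ((1 - κ * ∑ i, U i z ^ 2) * ∑ i, fderiv ℝ (U i) z (0, basisVec i)
        + κ * ∑ i, U i z * (fderiv ℝ (U i) z (1, 0)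
          + ∑ j, U j z * fderiv ℝ (U i) z (0, basisVec j))) := by
  have e1 : ∀ d, fderiv ℝ H z d = fderiv ℝ m z d - κ * fderiv ℝ p z d := by
    intro d
    rw [hH.fderiv_eq, fderiv_fun_sub hm (hp.const_mul κ), fderiv_const_mul hp]
    simp
  have e2 : ∀ i d, fderiv ℝ (fun z => m z * U i z) z d
      = m z * fderiv ℝ (U i) z d + U i z * fderiv ℝ m z d := by
    intro i d
    rw [fderiv_fun_mul hm (hU i)]
    simp
  have e3 : ∀ i j d, fderiv ℝ (fun z => m z * U i z * U j z + if j = i then p z else 0) z d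
      = m z * U i z * fderiv ℝ (U j) z d
        + U j z * (m z * fderiv ℝ (U i) z d + U i z * fderiv ℝ m z d)
        + if j = i then fderiv ℝ p z d else 0 := by
    intro i j d
    have hd : DifferentiableAt ℝ (fun z => m z * U i z * U j z) z := (hm.mul (hU i)).mul (hU j)
    have hif : DifferentiableAt ℝ (fun z => if j = i then p z else 0) z := by
      split_ifs
      · exact hp
      · exact differentiableAt_const 0
    rw [fderiv_fun_add hd hif, fderiv_fun_mul (hm.fun_mul (hU i)) (hU j),
      fderiv_fun_mul hm (hU i)]
    split_ifs <;> simp <;> ring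
  -- This is the algebraic constraint `m (1 - κ |U|²) = R + κ p`, differentiated in direction `d`.
  have e4 : ∀ d, fderiv ℝ m z d * (1 - κ * ∑ i, U i z ^ 2)
      - 2 * κ * m z * ∑ i, U i z * fderiv ℝ (U i) z d = fderiv ℝ R z d + κ * fderiv ℝ p z d := by
    intro d
    have hsq : ∀ i, HasFDerivAt (fun z => U i z ^ 2) ((2 * U i z) • fderiv ℝ (U i) z) z := by
      intro i
      simpa using (hU i).hasFDerivAt.pow 2
    have h1 := (hm.hasFDerivAt.mul ((HasFDerivAt.fun_sum fun i (_ : i ∈ Finset.univ) =>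
      hsq i).const_mul κ |>.const_sub 1)).fderiv
    have h2 := congrArg (fun L : ℝ × E3 →L[ℝ] ℝ => L d) (hcon.fderiv_eq (𝕜 := ℝ))
    erw [h1] at h2
    rw [fderiv_fun_add hR (hp.const_mul κ), fderiv_const_mul hp] at h2
    simp [Fin.sum_univ_three] at h2
    simp only [Fin.sum_univ_three]
    linarith
  simp only [e1, e2] at henergy
  simp only [e2, e3] at hmom
  have m0 := hmom 0
  have m1 := hmom 1
  have m2 := hmom 2
  have ct := e4 (1, 0)
  have c0 := e4 (0, basisVec 0)
  have c1 := e4 (0, basisVec 1)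
  have c2 := e4 (0, basisVec 2)
  simp [Fin.sum_univ_three] at henergy m0 m1 m2 ct c0 c1 c2 ⊢
  -- Energy minus `κ U ·` momentum, minus the constraint differentiated along `(1, U)`: all
  -- derivatives of `m` and `p` cancel.
  linear_combination henergy - κ * (U 0 z * m0 + U 1 z * m1 + U 2 z * m2)
    - (ct + U 0 z * c0 + U 1 z * c1 + U 2 z * c2)

/-! ### Algebra of the pressure law and of the relativistic densities -/

lemma contDiff_pressure {k γ : ℝ} (hγ : 1 ≤ γ) : ContDiff ℝ 1 (pressure k γ) :=
  contDiff_const.mul (by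
    have := Real.contDiff_rpow_const_of_le (n := 1) (p := γ) (by simpa using hγ)
    simpa using this)

lemma pressure_zero {k γ : ℝ} (hγ : 1 ≤ γ) : pressure k γ 0 = 0 := by
  rw [pressure, Real.zero_rpow (by linarith), mul_zero]

lemma pressure_nonneg {k γ r : ℝ} (hr : 0 ≤ r) : 0 ≤ pressure k γ r := by
  unfold pressure; positivity

/-- Splitting off a factor `r` shows that the right side of the density equation is linear in `ρ`;
the cofactor stays continuous at vacuum because `γ - 1 ≥ 0`. -/
lemma pressure_eq_mul {k γ r : ℝ} (hγ : 1 ≤ γ) (hr : 0 ≤ r) :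
    pressure k γ r = r * (k ^ 2 * r ^ (γ - 1)) := by
  rw [pressure]
  rcases hr.eq_or_lt with rfl | hr
  · rw [Real.zero_rpow (by linarith)]; simp
  · rw [show γ = (γ - 1) + 1 by ring, Real.rpow_add hr, Real.rpow_one]; simp; ring

lemma one_sub_norm_sq_div_pos {c : ℝ} {v : E3} (hv : ‖v‖ < c) : 0 < 1 - ‖v‖ ^ 2 / c ^ 2 := by
  have hc : 0 < c := (norm_nonneg v).trans_lt hv
  rw [sub_pos, div_lt_one (by positivity)]
  exact pow_lt_pow_left₀ hv (norm_nonneg v) two_ne_zero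

lemma rhoTilde_zero {c k γ : ℝ} (hγ : 1 ≤ γ) (v : E3) : rhoTilde c k γ 0 v = 0 := by
  simp [rhoTilde, pressure_zero hγ]

lemma rhoHat_zero {c k γ : ℝ} (hγ : 1 ≤ γ) (v : E3) : rhoHat c k γ 0 v = 0 := by
  simp [rhoHat, pressure_zero hγ]

lemma rhoTilde_mul {c k γ r : ℝ} {v : E3} (hv : ‖v‖ < c) :
    rhoTilde c k γ r v * (1 - ‖v‖ ^ 2 / c ^ 2) = r + pressure k γ r / c ^ 2 := by
  rw [rhoTilde, div_mul_cancel₀ _ (one_sub_norm_sq_div_pos hv).ne']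

lemma rhoTilde_nonneg {c k γ r : ℝ} {v : E3} (hv : ‖v‖ < c) (hr : 0 ≤ r) :
    0 ≤ rhoTilde c k γ r v :=
  div_nonneg (add_nonneg hr (div_nonneg (pressure_nonneg hr) (by positivity)))
    (one_sub_norm_sq_div_pos hv).le

lemma rhoHat_eq_rhoTilde_sub {c k γ r : ℝ} {v : E3} (hv : ‖v‖ < c) :
    rhoHat c k γ r v = rhoTilde c k γ r v - pressure k γ r / c ^ 2 := by
  have hc : c ≠ 0 := ((norm_nonneg v).trans_lt hv).ne'
  have h := (one_sub_norm_sq_div_pos hv).ne'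
  rw [rhoHat, rhoTilde, eq_sub_iff_add_eq, div_add' _ _ _ h]
  congr 1
  field_simp
  ring

/-- The energy density is the rest density plus the kinetic energy. -/
lemma rhoHat_eq_add {c k γ r : ℝ} {v : E3} (hv : ‖v‖ < c) :
    rhoHat c k γ r v = r + rhoTilde c k γ r v * ‖v‖ ^ 2 / c ^ 2 := by
  have := rhoTilde_mul (k := k) (γ := γ) (r := r) hv
  rw [rhoHat_eq_rhoTilde_sub hv]
  linarith [mul_div_assoc (rhoTilde c k γ r v) (‖v‖ ^ 2) (c ^ 2)]

/-! ### Regularity, pointwise balance laws and transport for regular solutions -/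

namespace IsRegularSolution

variable {c k γ T : ℝ} {ρ₀ : E3 → ℝ} {u₀ : E3 → E3} {ρ : ℝ → E3 → ℝ} {u : ℝ → E3 → E3}

lemma contDiffOn_velocity_apply (h : IsRegularSolution c k γ ρ₀ u₀ T ρ u) (i : Fin 3) :
    ContDiffOn ℝ 1 (fun z : ℝ × E3 => u z.1 z.2 i) (Icc 0 T ×ˢ univ) :=
  (contDiffOn_euclidean.1 h.velocity_c1) i

lemma contDiffOn_pressure (h : IsRegularSolution c k γ ρ₀ u₀ T ρ u) (hγ : 1 ≤ γ) :
    ContDiffOn ℝ 1 (fun z : ℝ × E3 => pressure k γ (ρ z.1 z.2)) (Icc 0 T ×ˢ univ) :=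
  (contDiff_pressure hγ).comp_contDiffOn h.density_c1

lemma contDiffOn_rhoTilde (h : IsRegularSolution c k γ ρ₀ u₀ T ρ u) (hγ : 1 ≤ γ) :
    ContDiffOn ℝ 1 (fun z : ℝ × E3 => rhoTilde c k γ (ρ z.1 z.2) (u z.1 z.2))
      (Icc 0 T ×ˢ univ) := by
  refine (h.density_c1.add ((h.contDiffOn_pressure hγ).div_const _)).div
    (contDiffOn_const.sub ((h.velocity_c1.norm_sq ℝ).div_const _)) fun z hz => ?_
  exact (one_sub_norm_sq_div_pos (h.subluminal z.1 hz.1 z.2)).ne'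

lemma contDiffOn_rhoHat (h : IsRegularSolution c k γ ρ₀ u₀ T ρ u) (hγ : 1 ≤ γ) :
    ContDiffOn ℝ 1 (fun z : ℝ × E3 => rhoHat c k γ (ρ z.1 z.2) (u z.1 z.2))
      (Icc 0 T ×ˢ univ) :=
  ((h.contDiffOn_rhoTilde hγ).sub ((h.contDiffOn_pressure hγ).div_const (c ^ 2))).congr
    fun z hz => rhoHat_eq_rhoTilde_sub (h.subluminal z.1 hz.1 z.2)

lemma contDiffOn_momentum (h : IsRegularSolution c k γ ρ₀ u₀ T ρ u) (hγ : 1 ≤ γ) (i : Fin 3) :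
    ContDiffOn ℝ 1 (fun z : ℝ × E3 => rhoTilde c k γ (ρ z.1 z.2) (u z.1 z.2) * u z.1 z.2 i)
      (Icc 0 T ×ˢ univ) :=
  (h.contDiffOn_rhoTilde hγ).mul (h.contDiffOn_velocity_apply i)

lemma contDiffOn_momentumFlux (h : IsRegularSolution c k γ ρ₀ u₀ T ρ u) (hγ : 1 ≤ γ)
    (i j : Fin 3) :
    ContDiffOn ℝ 1 (fun z : ℝ × E3 =>
      rhoTilde c k γ (ρ z.1 z.2) (u z.1 z.2) * u z.1 z.2 i * u z.1 z.2 j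
        + if j = i then pressure k γ (ρ z.1 z.2) else 0) (Icc 0 T ×ˢ univ) := by
  refine ((h.contDiffOn_momentum hγ i).mul (h.contDiffOn_velocity_apply j)).add ?_
  split_ifs
  · exact h.contDiffOn_pressure hγ
  · exact contDiffOn_const

lemma isOpen_openSlab (T : ℝ) : IsOpen (Ioo 0 T ×ˢ (univ : Set E3)) := isOpen_Ioo.prod isOpen_univ

lemma openSlab_subset (T : ℝ) : Ioo 0 T ×ˢ (univ : Set E3) ⊆ Icc 0 T ×ˢ univ :=
  prod_mono Ioo_subset_Icc_self le_rfl

/-- The energy equation holds pointwise. -/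
lemma energy_eq (h : IsRegularSolution c k γ ρ₀ u₀ T ρ u) (hγ : 1 ≤ γ)
    {z : ℝ × E3} (hz : z ∈ Ioo 0 T ×ˢ (univ : Set E3)) :
    fderiv ℝ (fun z : ℝ × E3 => rhoHat c k γ (ρ z.1 z.2) (u z.1 z.2)) z (1, 0)
      + ∑ j, fderiv ℝ (fun z : ℝ × E3 =>
        rhoTilde c k γ (ρ z.1 z.2) (u z.1 z.2) * u z.1 z.2 j) z (0, basisVec j) = 0 := by
  -- The equation is a space-time divergence: in `Option (Fin 3)`, `none` stands for time and `some
  -- j` for the spatial directions.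
  have key := sum_fderiv_eq_zero_of_weak (μ := (volume : Measure (ℝ × E3))) (isOpen_openSlab T)
    (a := fun o : Option (Fin 3) => o.elim
      (fun z : ℝ × E3 => rhoHat c k γ (ρ z.1 z.2) (u z.1 z.2))
      (fun j z => rhoTilde c k γ (ρ z.1 z.2) (u z.1 z.2) * u z.1 z.2 j))
    (v := fun o => o.elim (1, 0) (fun j => (0, basisVec j)))
    (by
      rintro (_ | j)
      · exact (h.contDiffOn_rhoHat hγ).mono (openSlab_subset T)
      · exact (h.contDiffOn_momentum hγ j).mono (openSlab_subset T))
    (by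
      intro φ hφ hc hs
      refine Eq.trans ?_ (h.weak_energy φ ⟨hφ, hc, hs⟩)
      congr 1
      ext z
      simp only [Fintype.sum_option, Option.elim, dt, dx]
      rw [map_eq_sum_basisVec, Finset.mul_sum]
      simp_rw [mul_assoc])
    z hz
  simpa [Fintype.sum_option] using key

/-- The momentum equations hold pointwise. -/
lemma momentum_eq (h : IsRegularSolution c k γ ρ₀ u₀ T ρ u) (hγ : 1 ≤ γ) (i : Fin 3)
    {z : ℝ × E3} (hz : z ∈ Ioo 0 T ×ˢ (univ : Set E3)) :
    fderiv ℝ (fun z : ℝ × E3 => rhoTilde c k γ (ρ z.1 z.2) (u z.1 z.2) * u z.1 z.2 i) z (1, 0)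
      + ∑ j, fderiv ℝ (fun z : ℝ × E3 =>
        rhoTilde c k γ (ρ z.1 z.2) (u z.1 z.2) * u z.1 z.2 i * u z.1 z.2 j
          + if j = i then pressure k γ (ρ z.1 z.2) else 0) z (0, basisVec j) = 0 := by
  have key := sum_fderiv_eq_zero_of_weak (μ := (volume : Measure (ℝ × E3))) (isOpen_openSlab T)
    (a := fun o : Option (Fin 3) => o.elim
      (fun z : ℝ × E3 => rhoTilde c k γ (ρ z.1 z.2) (u z.1 z.2) * u z.1 z.2 i)
      (fun j z => rhoTilde c k γ (ρ z.1 z.2) (u z.1 z.2) * u z.1 z.2 i * u z.1 z.2 j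
          + if j = i then pressure k γ (ρ z.1 z.2) else 0))
    (v := fun o => o.elim (1, 0) (fun j => (0, basisVec j)))
    (by
      rintro (_ | j)
      · exact (h.contDiffOn_momentum hγ i).mono (openSlab_subset T)
      · exact (h.contDiffOn_momentumFlux hγ i j).mono (openSlab_subset T))
    (by
      intro φ hφ hc hs
      refine Eq.trans ?_ (h.weak_momentum φ ⟨hφ, hc, hs⟩ i)
      congr 1
      ext z
      simp only [Fintype.sum_option, Option.elim, dt, dx]
      rw [map_eq_sum_basisVec _ (u z.1 z.2), Finset.mul_sum]
      simp_rw [add_mul, Finset.sum_add_distrib, ite_mul, zero_mul]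
      rw [Finset.sum_ite_eq' Finset.univ i]
      simp [mul_assoc, add_assoc])
    z hz
  simpa [Fintype.sum_option] using key

lemma uniqueDiffOn_slab (h : IsRegularSolution c k γ ρ₀ u₀ T ρ u) :
    UniqueDiffOn ℝ (Icc 0 T ×ˢ (univ : Set E3)) :=
  (uniqueDiffOn_Icc h.pos_time).prod uniqueDiffOn_univ

lemma slab_mem_nhds {z : ℝ × E3} (hz : z ∈ Ioo 0 T ×ˢ (univ : Set E3)) :
    Icc 0 T ×ˢ (univ : Set E3) ∈ 𝓝 z :=
  Filter.mem_of_superset ((isOpen_openSlab T).mem_nhds hz) (openSlab_subset T)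

/-- Along the flow the density obeys a linear equation with continuous coefficient. -/
lemma exists_density_transport (h : IsRegularSolution c k γ ρ₀ u₀ T ρ u) (hγ : 1 ≤ γ) :
    ∃ g : ℝ × E3 → ℝ, ContinuousOn g (Icc 0 T ×ˢ univ) ∧
      ∀ z ∈ Ioo 0 T ×ˢ (univ : Set E3),
        fderiv ℝ (fun z : ℝ × E3 => ρ z.1 z.2) z (1, u z.1 z.2) = g z * ρ z.1 z.2 := by
  set S : Set (ℝ × E3) := Icc 0 T ×ˢ univ with hS
  set U : Fin 3 → ℝ × E3 → ℝ := fun i z => u z.1 z.2 i with hUdef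
  set κ : ℝ := 1 / c ^ 2 with hκ
  have hUc := fun i => h.contDiffOn_velocity_apply i
  -- Derivatives within the closed slab are continuous up to `t = 0` and `t = T`, so the coefficient
  -- is bounded on whole particle paths.
  have hD : ∀ i (d : ℝ × E3), ContinuousOn (fun z => fderivWithin ℝ (U i) S z d) S := fun i d =>
    ((hUc i).continuousOn_fderivWithin h.uniqueDiffOn_slab le_rfl).clm_apply continuousOn_const
  have hden : ∀ z ∈ S, 1 - ‖u z.1 z.2‖ ^ 2 / c ^ 2 ≠ 0 := fun z hz =>
    (one_sub_norm_sq_div_pos (h.subluminal z.1 hz.1 z.2)).ne'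
  -- This is the quotient `ρ̃ / ρ`, extended continuously to vacuum.
  have hcoef : ContinuousOn (fun z : ℝ × E3 => (1 + k ^ 2 * ρ z.1 z.2 ^ (γ - 1) / c ^ 2) /
      (1 - ‖u z.1 z.2‖ ^ 2 / c ^ 2)) S := by
    refine ContinuousOn.div ?_ ?_ hden
    · exact continuousOn_const.add ((continuousOn_const.mul
        (h.density_c1.continuousOn.rpow_const fun z _ => Or.inr (by linarith))).div_const _)
    · exact continuousOn_const.sub ((h.velocity_c1.continuousOn.norm.pow 2).div_const _)
  refine ⟨fun z => -((1 + k ^ 2 * ρ z.1 z.2 ^ (γ - 1) / c ^ 2) /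
      (1 - ‖u z.1 z.2‖ ^ 2 / c ^ 2)) *
    ((1 - κ * ∑ i, U i z ^ 2) * ∑ i, fderivWithin ℝ (U i) S z (0, basisVec i)
        + κ * ∑ i, U i z * (fderivWithin ℝ (U i) S z (1, 0)
          + ∑ j, U j z * fderivWithin ℝ (U i) S z (0, basisVec j))), ?_, ?_⟩
  · have hU' := fun i => (hUc i).continuousOn
    refine hcoef.neg.mul (ContinuousOn.add (ContinuousOn.mul ?_ ?_) ?_)
    · exact continuousOn_const.sub (continuousOn_const.mul
        (continuousOn_finsetSum _ fun i _ => (hU' i).pow 2))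
    · exact continuousOn_finsetSum _ fun i _ => hD i _
    · exact continuousOn_const.mul (continuousOn_finsetSum _ fun i _ => (hU' i).mul
        ((hD i _).add (continuousOn_finsetSum _ fun j _ => (hU' j).mul (hD i _))))
  · intro z hz
    have hn : S ∈ 𝓝 z := slab_mem_nhds hz
    have hd : ∀ {f : ℝ × E3 → ℝ}, ContDiffOn ℝ 1 f S → DifferentiableAt ℝ f z := fun hf =>
      ((hf.contDiffAt hn).differentiableAt one_ne_zero)
    have key := density_transport_of_balance (κ := κ) (U := U) (hd h.density_c1)
      (hd (h.contDiffOn_pressure hγ)) (hd (h.contDiffOn_rhoTilde hγ)) (fun i => hd (hUc i))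
      (H := fun z : ℝ × E3 => rhoHat c k γ (ρ z.1 z.2) (u z.1 z.2))
      (by
        filter_upwards [hn] with y hy
        rw [rhoHat_eq_rhoTilde_sub (h.subluminal y.1 hy.1 y.2)]
        ring)
      (by
        filter_upwards [hn] with y hy
        have := rhoTilde_mul (k := k) (γ := γ) (r := ρ y.1 y.2) (h.subluminal y.1 hy.1 y.2)
        rw [norm_sq_eq_sum] at this
        rw [show κ * ∑ i, U i y ^ 2 = (∑ i, u y.1 y.2 i ^ 2) / c ^ 2 by rw [hκ]; ring, this]
        ring)
      (h.energy_eq hγ hz) (fun i => h.momentum_eq hγ i hz)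
    rw [map_eq_time_add_sum]
    refine key.trans ?_
    simp only [fderivWithin_of_mem_nhds hn]
    have hm : rhoTilde c k γ (ρ z.1 z.2) (u z.1 z.2) =
        ρ z.1 z.2 * ((1 + k ^ 2 * ρ z.1 z.2 ^ (γ - 1) / c ^ 2) /
          (1 - ‖u z.1 z.2‖ ^ 2 / c ^ 2)) := by
      rw [rhoTilde, pressure_eq_mul hγ (h.density_nonneg z.1 (Ioo_subset_Icc_self hz.1) z.2)]
      ring
    rw [hm]
    ring

/-- In vacuum the velocity is transported. -/
lemma velocity_transport (h : IsRegularSolution c k γ ρ₀ u₀ T ρ u)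
    {z : ℝ × E3} (hz : z ∈ Ioo 0 T ×ˢ (univ : Set E3)) (h0 : ρ z.1 z.2 = 0) :
    fderiv ℝ (fun z : ℝ × E3 => u z.1 z.2) z (1, u z.1 z.2) = 0 := by
  have hn := slab_mem_nhds hz
  have hd := (h.velocity_c1.contDiffAt hn).differentiableAt one_ne_zero |>.hasFDerivAt
  have ht : HasDerivAt (fun s => u s z.2)
      (fderiv ℝ (fun z : ℝ × E3 => u z.1 z.2) z (1, 0)) z.1 :=
    hd.comp_hasDerivAt (f := fun s : ℝ => (s, z.2)) z.1
      ((hasDerivAt_id z.1).prodMk (hasDerivAt_const z.1 z.2))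
  have hx : HasFDerivAt (u z.1) _ z.2 :=
    hd.comp (f := fun y : E3 => (z.1, y)) z.2
      ((hasFDerivAt_const z.1 z.2).prodMk (hasFDerivAt_id z.2))
  have key := h.vacuum_eq z.1 (Ioo_subset_Icc_self hz.1) z.2 h0
  rw [ht.hasDerivWithinAt.derivWithin (uniqueDiffOn_Icc h.pos_time z.1
    (Ioo_subset_Icc_self hz.1)), hx.fderiv] at key
  rw [← key]
  simp only [ContinuousLinearMap.comp_apply, ContinuousLinearMap.prod_apply,
    zero_apply, ContinuousLinearMap.id_apply]
  rw [← map_add]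
  simp

end IsRegularSolution

/-! ### Particle paths and propagation of vacuum -/

/-- `X` is a particle path of the velocity field `u` on the time interval `[0, T]`. -/
def IsParticlePath (T : ℝ) (u : ℝ → E3 → E3) (X : ℝ → E3) : Prop :=
  ∀ s ∈ Icc 0 T, HasDerivWithinAt X (u s (X s)) (Icc 0 T) s

lemma IsParticlePath.continuousOn {T : ℝ} {u : ℝ → E3 → E3} {X : ℝ → E3}
    (hX : IsParticlePath T u X) :
    ContinuousOn X (Icc 0 T) := fun s hs => (hX s hs).continuousWithinAt

lemma IsParticlePath.hasDerivAt {T : ℝ} {u : ℝ → E3 → E3} {X : ℝ → E3}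
    (hX : IsParticlePath T u X) {s : ℝ} (hs : s ∈ Ioo 0 T) : HasDerivAt X (u s (X s)) s :=
  (hX s (Ioo_subset_Icc_self hs)).hasDerivAt (Icc_mem_nhds hs.1 hs.2)

namespace IsRegularSolution

variable {c k γ T : ℝ} {ρ₀ : E3 → ℝ} {u₀ : E3 → E3} {ρ : ℝ → E3 → ℝ} {u : ℝ → E3 → E3}
  {X : ℝ → E3}

/-- A `C¹` map is Lipschitz on the compact convex set `[0, T] × closedBall x M`; freezing time gives
a constant independent of `s`. -/
lemma exists_lipschitzOnWith (h : IsRegularSolution c k γ ρ₀ u₀ T ρ u) (x : E3) (M : ℝ) :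
    ∃ K : NNReal, ∀ s ∈ Icc 0 T, LipschitzOnWith K (u s) (Metric.closedBall x M) := by
  obtain ⟨K, hK⟩ := (h.velocity_c1.mono (prod_mono le_rfl
    (subset_univ (Metric.closedBall x M)))).exists_lipschitzOnWith one_ne_zero
    ((convex_Icc 0 T).prod (convex_closedBall x M)) (isCompact_Icc.prod (isCompact_closedBall x M))
  refine ⟨K, fun s hs y hy z hz => ?_⟩
  have := hK (show (s, y) ∈ Icc 0 T ×ˢ Metric.closedBall x M from ⟨hs, hy⟩)
    (show (s, z) ∈ Icc 0 T ×ˢ Metric.closedBall x M from ⟨hs, hz⟩)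
  simpa [Prod.edist_eq] using this

/-- Because speeds stay below `c`, a path cannot leave the ball of radius `c T` about `x`, so
Picard–Lindelöf applies on all of `[0, T]` at once. Prescribing the position at an arbitrary time
allows tracing particles backwards. -/
lemma exists_particlePath (h : IsRegularSolution c k γ ρ₀ u₀ T ρ u) {t : ℝ} (ht : t ∈ Icc 0 T)
    (x : E3) : ∃ X, X t = x ∧ IsParticlePath T u X := by
  have hc : 0 ≤ c := (norm_nonneg _).trans (h.subluminal t ht x).le
  have hT := h.pos_time.le
  obtain ⟨K, hK⟩ := h.exists_lipschitzOnWith x (c * T)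
  have hPL : IsPicardLindelof u (⟨t, ht⟩ : Icc (0 : ℝ) T) x ⟨c * T, mul_nonneg hc hT⟩ 0 ⟨c, hc⟩ K :=
    { lipschitzOnWith := hK
      continuousOn := fun y _ => h.velocity_c1.continuousOn.comp
        (by fun_prop : Continuous fun s : ℝ => (s, y)).continuousOn fun s hs => ⟨hs, mem_univ _⟩
      norm_le := fun s hs y _ => (h.subluminal s hs y).le
      mul_max_le := by
        simp only [NNReal.coe_zero, sub_zero]
        exact mul_le_mul_of_nonneg_left (max_le (by linarith [ht.1]) (by linarith [ht.2])) hc }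
  exact hPL.exists_eq_forall_mem_Icc_hasDerivWithinAt₀

lemma norm_path_sub_le (h : IsRegularSolution c k γ ρ₀ u₀ T ρ u) (hX : IsParticlePath T u X)
    {s t : ℝ} (hs : s ∈ Icc 0 T) (ht : t ∈ Icc 0 T) : ‖X t - X s‖ ≤ c * T := by
  have hc : 0 ≤ c := (norm_nonneg _).trans (h.subluminal t ht 0).le
  refine ((convex_Icc 0 T).norm_image_sub_le_of_norm_hasDerivWithin_le hX
    (fun s hs => (h.subluminal s hs _).le) hs ht).trans (mul_le_mul_of_nonneg_left ?_ hc)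
  rw [Real.norm_eq_abs, abs_le]
  constructor <;> linarith [hs.1, hs.2, ht.1, ht.2]

/-- Particle paths starting in a bounded set stay comparable in distance. -/
lemma exists_path_dist_le (h : IsRegularSolution c k γ ρ₀ u₀ T ρ u) (M : ℝ) :
    ∃ C : ℝ, 0 < C ∧ ∀ X Y : ℝ → E3, IsParticlePath T u X → IsParticlePath T u Y →
      ‖X 0‖ ≤ M → ‖Y 0‖ ≤ M → ∀ s ∈ Icc 0 T, ∀ t ∈ Icc 0 T, ‖X t - Y t‖ ≤ C * ‖X s - Y s‖ := by
  obtain ⟨K, hK⟩ := h.exists_lipschitzOnWith 0 (M + c * T)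
  refine ⟨Real.exp (K * T), Real.exp_pos _, fun X Y hX hY hX0 hY0 s hs t ht => ?_⟩
  have hmem : ∀ {Z : ℝ → E3}, IsParticlePath T u Z → ‖Z 0‖ ≤ M → ∀ s ∈ Icc 0 T,
      Z s ∈ Metric.closedBall (0 : E3) (M + c * T) := by
    intro Z hZ hZ0 s hs
    rw [mem_closedBall_zero_iff]
    have h1 := h.norm_path_sub_le hZ (left_mem_Icc.2 h.pos_time.le) hs
    have h2 := norm_add_le (Z 0) (Z s - Z 0)
    rw [add_sub_cancel] at h2
    linarith
  refine norm_le_exp_mul_norm (f := fun s => X s - Y s)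
    (f' := fun s => u s (X s) - u s (Y s)) K.coe_nonneg (hX.continuousOn.sub hY.continuousOn)
    (fun s hs => (hX.hasDerivAt hs).sub (hY.hasDerivAt hs)) (fun s hs => ?_) hs ht
  have hs' := Ioo_subset_Icc_self hs
  exact (hK s hs').norm_sub_le (hmem hX hX0 s hs') (hmem hY hY0 s hs')

/-- Vacuum is carried along particle paths. -/
lemma density_eq_zero_along_path (h : IsRegularSolution c k γ ρ₀ u₀ T ρ u) (hγ : 1 ≤ γ)
    (hX : IsParticlePath T u X) {s t : ℝ} (hs : s ∈ Icc 0 T) (ht : t ∈ Icc 0 T)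
    (h0 : ρ s (X s) = 0) : ρ t (X t) = 0 := by
  obtain ⟨g, hg, heq⟩ := h.exists_density_transport hγ
  have hpath : ContinuousOn (fun s => (s, X s)) (Icc 0 T) := continuousOn_id.prodMk hX.continuousOn
  have hmaps : MapsTo (fun s => (s, X s)) (Icc 0 T) (Icc 0 T ×ˢ (univ : Set E3)) :=
    fun s hs => ⟨hs, mem_univ _⟩
  obtain ⟨C, hC⟩ := isCompact_Icc.exists_bound_of_continuousOn (hg.comp hpath hmaps)
  have hb := norm_le_exp_mul_norm (T := T) (K := max C 0) (f := fun s => ρ s (X s))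
    (f' := fun s => g (s, X s) * ρ s (X s)) (le_max_right _ _)
    (h.density_c1.continuousOn.comp hpath hmaps) (fun s hs => ?_) (fun s hs => ?_) hs ht
  · simpa [h0] using hb
  · have hz : (s, X s) ∈ Ioo 0 T ×ˢ (univ : Set E3) := ⟨hs, mem_univ _⟩
    have hd := (h.density_c1.contDiffAt (slab_mem_nhds hz)).differentiableAt one_ne_zero
      |>.hasFDerivAt
    rw [← heq _ hz]
    exact hd.comp_hasDerivAt (f := fun s : ℝ => (s, X s)) s
      ((hasDerivAt_id s).prodMk (hX.hasDerivAt hs))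
  · rw [norm_mul]
    gcongr
    exact (hC s (Ioo_subset_Icc_self hs)).trans (le_max_left _ _)

/-- Particles starting in vacuum move along straight lines. -/
lemma path_eq_line (h : IsRegularSolution c k γ ρ₀ u₀ T ρ u) (hγ : 1 ≤ γ)
    (hX : IsParticlePath T u X) (h0 : ρ₀ (X 0) = 0) {t : ℝ} (ht : t ∈ Icc 0 T) :
    X t = X 0 + t • u₀ (X 0) := by
  have h0T : (0 : ℝ) ∈ Icc 0 T := left_mem_Icc.2 h.pos_time.le
  have hvac : ∀ s ∈ Icc 0 T, ρ s (X s) = 0 := fun s hs =>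
    h.density_eq_zero_along_path hγ hX h0T hs (by rw [h.init_density, h0])
  have hpath : ContinuousOn (fun s => (s, X s)) (Icc 0 T) := continuousOn_id.prodMk hX.continuousOn
  have hu : ∀ s ∈ Icc 0 T, u s (X s) = u₀ (X 0) := by
    intro s hs
    -- With `K = 0` the Grönwall estimate says that a function with zero derivative keeps its
    -- initial value.
    have hb := norm_le_exp_mul_norm (T := T) (K := 0) (f := fun s => u s (X s) - u₀ (X 0))
      (f' := fun _ => 0) le_rfl
      ((h.velocity_c1.continuousOn.comp hpath fun s hs => ⟨hs, mem_univ _⟩).sub continuousOn_const)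
      (fun s hs => ?_) (fun s hs => by simp) h0T hs
    · rw [h.init_velocity, sub_self, norm_zero, mul_zero] at hb
      exact sub_eq_zero.1 (norm_le_zero_iff.1 hb)
    · have hz : (s, X s) ∈ Ioo 0 T ×ˢ (univ : Set E3) := ⟨hs, mem_univ _⟩
      have hd := (h.velocity_c1.contDiffAt (slab_mem_nhds hz)).differentiableAt one_ne_zero
        |>.hasFDerivAt
      rw [← h.velocity_transport hz (hvac s (Ioo_subset_Icc_self hs))]
      exact (hd.comp_hasDerivAt (f := fun s : ℝ => (s, X s)) s
        ((hasDerivAt_id s).prodMk (hX.hasDerivAt hs))).sub_const _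
  have hb := norm_le_exp_mul_norm (T := T) (K := 0) (f := fun s => X s - (X 0 + s • u₀ (X 0)))
    (f' := fun _ => 0) le_rfl (hX.continuousOn.sub (by fun_prop)) (fun s hs => ?_)
    (fun s hs => by simp) h0T ht
  · simp only [zero_smul, add_zero, sub_self, norm_zero, mul_zero] at hb
    exact sub_eq_zero.1 (norm_le_zero_iff.1 hb)
  · have h1 := hX.hasDerivAt hs
    rw [hu s (Ioo_subset_Icc_self hs)] at h1
    refine (h1.sub (((hasDerivAt_id s).smul_const (u₀ (X 0))).const_add (X 0))).congr_deriv ?_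
    rw [one_smul, sub_self]

/-- The group stays isolated: it is carried rigidly by the common velocity `ubar` of its boundary,
and is surrounded by vacuum. -/
lemma exists_vacuum_annulus (h : IsRegularSolution c k γ ρ₀ u₀ T ρ u) (hγ : 1 ≤ γ)
    {A₀ B₀ : Set E3} (hAB : IsIsolatedMassGroup c k γ ρ₀ u₀ A₀ B₀) {ubar : E3}
    (hub : ∀ x ∈ frontier A₀, u₀ x = ubar) :
    ∃ ε > 0, ∀ t ∈ Icc 0 T, ∀ y ∈ Metric.thickening ε A₀ \ A₀, ρ t (y + t • ubar) = 0 := by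
  obtain ⟨R, hR, hBR⟩ := hAB.bounded
  have h0T : (0 : ℝ) ∈ Icc 0 T := left_mem_Icc.2 h.pos_time.le
  have hc : 0 < c := (norm_nonneg _).trans_lt (h.subluminal 0 h0T 0)
  have hT := h.pos_time
  have hfrB : frontier A₀ ⊆ B₀ := frontier_subset_closure.trans hAB.closure_subset
  have hfrc : IsCompact (frontier A₀) := Metric.isCompact_of_isClosed_isBounded isClosed_frontier
    (Metric.isBounded_ball.subset (hfrB.trans hBR))
  have hfrA : ∀ p ∈ frontier A₀, p ∉ A₀ := fun p hp hpA =>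
    hp.2 (by rwa [hAB.isOpen_A.interior_eq])
  obtain ⟨δ, hδ, hδB⟩ := hfrc.exists_thickening_subset_open hAB.isOpen_B hfrB
  -- The points `y` considered satisfy `‖y‖ < R + 1`. One `c T` covers the shift by `t • ubar`, the
  -- other the motion of the particle back to time `0`.
  obtain ⟨C, hC, hdist⟩ := h.exists_path_dist_le (R + 1 + 2 * (c * T))
  have hline : ∀ p ∈ frontier A₀, ∃ P, IsParticlePath T u P ∧ P 0 = p ∧
      ‖P 0‖ ≤ R + 1 + 2 * (c * T) ∧ ∀ s ∈ Icc 0 T, P s = p + s • ubar := by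
    intro p hp
    obtain ⟨P, hP0, hP⟩ := h.exists_particlePath h0T p
    refine ⟨P, hP, hP0, ?_, fun s hs => ?_⟩
    · have := mem_ball_zero_iff.1 (hBR (hfrB hp))
      rw [hP0]
      nlinarith [mul_pos hc hT]
    · rw [h.path_eq_line hγ hP (by rw [hP0]; exact hAB.vacuum p ⟨hfrB hp, hfrA p hp⟩) hs, hP0,
        hub p hp]
  refine ⟨min 1 (δ / C), by positivity, fun t ht y ⟨hyN, hyA⟩ => ?_⟩
  obtain ⟨a, haA, hya⟩ := Metric.mem_thickening_iff.1 hyN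
  obtain ⟨p, hpseg, hp⟩ := exists_mem_frontier_of_isPreconnected
    (convex_segment a y).isPreconnected hAB.isOpen_A ⟨a, left_mem_segment ℝ a y, haA⟩
    ⟨y, right_mem_segment ℝ a y, hyA⟩
  have hyp : ‖y - p‖ < min 1 (δ / C) := by
    have := (convex_ball y (min 1 (δ / C))).segment_subset
      (Metric.mem_ball.2 (by rwa [dist_comm]))
      (Metric.mem_ball_self (by positivity)) hpseg
    rwa [Metric.mem_ball, dist_comm, dist_eq_norm] at this
  obtain ⟨P, hP, hP0, hPM, hPline⟩ := hline p hp
  obtain ⟨X, hXt, hX⟩ := h.exists_particlePath ht (y + t • ubar)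
  have hXM : ‖X 0‖ ≤ R + 1 + 2 * (c * T) := by
    have h1 := h.norm_path_sub_le hX ht h0T
    have h2 : ‖X 0‖ ≤ ‖X 0 - X t‖ + ‖X t‖ := by simpa using norm_add_le (X 0 - X t) (X t)
    have h3 : ‖X t‖ ≤ ‖y‖ + t * ‖ubar‖ := by
      rw [hXt]
      refine (norm_add_le _ _).trans ?_
      rw [norm_smul, Real.norm_of_nonneg ht.1]
    have h4 : ‖ubar‖ ≤ c := by
      rw [← hub p hp, ← h.init_velocity]
      exact (h.subluminal 0 h0T p).le
    have h5 : ‖y‖ ≤ ‖y - p‖ + ‖p‖ := by simpa using norm_add_le (y - p) p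
    have h6 := mem_ball_zero_iff.1 (hBR (hfrB hp))
    have h7 : ‖y - p‖ < 1 := hyp.trans_le (min_le_left _ _)
    have h8 : t * ‖ubar‖ ≤ T * c := mul_le_mul ht.2 h4 (norm_nonneg _) hT.le
    linarith
  -- At time `t` the path is within `δ / C` of the boundary path through `p`, hence at time `0`
  -- within `δ` of `p`.
  have hXB : X 0 ∈ B₀ := by
    refine hδB (Metric.mem_thickening_iff.2 ⟨p, hp, ?_⟩)
    have h1 := hdist X P hX hP hXM hPM t ht 0 h0T
    rw [hXt, hPline t ht, add_sub_add_right_eq_sub, hP0] at h1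
    rw [dist_eq_norm]
    refine h1.trans_lt ?_
    have h2 := hyp.trans_le (min_le_right _ _)
    rw [lt_div_iff₀ hC] at h2
    linarith
  -- A path starting in `A₀` would make `X s - s • ubar` cross the frontier, thus meet a boundary
  -- path. The distance estimate then forces both to start at the same point, a frontier point
  -- outside the open set `A₀`.
  have hXA : X 0 ∉ A₀ := by
    intro hXA
    have hsub : Icc 0 t ⊆ Icc 0 T := Icc_subset_Icc_right ht.2
    have hcont : ContinuousOn (fun s => X s - s • ubar) (Icc 0 t) :=
      (hX.continuousOn.mono hsub).sub (by fun_prop)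
    obtain ⟨q, ⟨s, hs, rfl⟩, hq⟩ := exists_mem_frontier_of_isPreconnected
      (isPreconnected_Icc.image _ hcont) hAB.isOpen_A
      ⟨X 0, ⟨0, left_mem_Icc.2 ht.1, by simp⟩, hXA⟩
      ⟨y, ⟨t, right_mem_Icc.2 ht.1, by simp [hXt]⟩, hyA⟩
    obtain ⟨Q, hQ, hQ0, hQM, hQline⟩ := hline _ hq
    have h1 := hdist X Q hX hQ hXM hQM s (hsub hs) 0 h0T
    rw [hQline s (hsub hs), hQ0] at h1
    simp only [sub_add_cancel, sub_self, norm_zero, mul_zero] at h1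
    have h2 := sub_eq_zero.1 (norm_le_zero_iff.1 h1)
    rw [h2] at hXA
    exact hfrA _ hq hXA
  rw [← hXt]
  exact h.density_eq_zero_along_path hγ hX h0T ht
    (by rw [h.init_density]; exact hAB.vacuum _ ⟨hXB, hXA⟩)

end IsRegularSolution

/-! ### Moments of an isolated group in the moving frame -/

/-- The moment of the density `f` with weight `q` over the translated region `A + t w`. -/
def movingMoment (A : Set E3) (w : E3) (f : ℝ × E3 → ℝ) (q : E3 → ℝ) (t : ℝ) : ℝ :=
  ∫ y in A, f (t, y + t • w) * q y

/-- `b` is a conserved density with flux `a`, and both vanish in vacuum. -/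
structure IsBalanceLaw (T : ℝ) (ρ : ℝ → E3 → ℝ) (b : ℝ × E3 → ℝ) (a : Fin 3 → ℝ × E3 → ℝ) :
    Prop where
  density_c1 : ContDiffOn ℝ 1 b (Icc 0 T ×ˢ univ)
  flux_c1 : ∀ j, ContDiffOn ℝ 1 (a j) (Icc 0 T ×ˢ univ)
  balance : ∀ z ∈ Ioo 0 T ×ˢ (univ : Set E3),
    fderiv ℝ b z (1, 0) + ∑ j, fderiv ℝ (a j) z (0, basisVec j) = 0
  density_vacuum : ∀ z : ℝ × E3, ρ z.1 z.2 = 0 → b z = 0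
  flux_vacuum : ∀ j, ∀ z : ℝ × E3, ρ z.1 z.2 = 0 → a j z = 0

lemma contDiff_shift (w : E3) : ContDiff ℝ 1 fun z : ℝ × E3 => (z.1, z.2 + z.1 • w) := by
  fun_prop

lemma fderiv_comp_shift {f : ℝ × E3 → ℝ} {w : E3} {z : ℝ × E3}
    (hf : DifferentiableAt ℝ f (z.1, z.2 + z.1 • w)) (d : ℝ × E3) :
    fderiv ℝ (fun z : ℝ × E3 => f (z.1, z.2 + z.1 • w)) z d
      = fderiv ℝ f (z.1, z.2 + z.1 • w) (d.1, d.2 + d.1 • w) := by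
  have h1 : HasFDerivAt (fun z : ℝ × E3 => (z.1, z.2 + z.1 • w)) _ z :=
    hasFDerivAt_fst.prodMk (hasFDerivAt_snd.add
      ((ContinuousLinearMap.fst ℝ ℝ E3).smulRight w).hasFDerivAt)
  have h2 : HasFDerivAt (fun z : ℝ × E3 => f (z.1, z.2 + z.1 • w)) _ z :=
    hf.hasFDerivAt.comp z h1
  rw [h2.fderiv]
  simp

section Moments

variable {T : ℝ} {ρ : ℝ → E3 → ℝ} {A : Set E3} {w : E3} {f : ℝ × E3 → ℝ} {q : E3 → ℝ}
  {b : ℝ × E3 → ℝ} {a : Fin 3 → ℝ × E3 → ℝ}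

lemma exists_moment_bound (hAb : Bornology.IsBounded A)
    (hf : ContinuousOn f (Icc 0 T ×ˢ univ)) (hq : Continuous q) :
    ∃ C, ∀ t ∈ Icc 0 T, ∀ y ∈ A, ‖f (t, y + t • w) * q y‖ ≤ C := by
  have hcont : ContinuousOn (fun z : ℝ × E3 => f (z.1, z.2 + z.1 • w) * q z.2)
      (Icc 0 T ×ˢ closure A) :=
    (hf.comp (contDiff_shift w).continuous.continuousOn fun z hz => ⟨hz.1, mem_univ _⟩).mul
      (hq.comp continuous_snd).continuousOn
  obtain ⟨C, hC⟩ := (isCompact_Icc.prod hAb.isCompact_closure).exists_bound_of_continuousOn hcont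
  exact ⟨C, fun t ht y hy => hC (t, y) ⟨ht, subset_closure hy⟩⟩

lemma continuous_slice (hf : ContinuousOn f (Icc 0 T ×ˢ univ)) {t : ℝ} (ht : t ∈ Icc 0 T) :
    Continuous fun y => f (t, y + t • w) :=
  hf.comp_continuous (by fun_prop) fun y => ⟨ht, mem_univ _⟩

lemma integrableOn_of_continuous {g : E3 → ℝ} (hAb : Bornology.IsBounded A) (hg : Continuous g) :
    IntegrableOn g A :=
  (hg.continuousOn.integrableOn_compact hAb.isCompact_closure).mono_set subset_closure

lemma continuousOn_movingMoment (hAb : Bornology.IsBounded A) (hA : IsOpen A)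
    (hf : ContinuousOn f (Icc 0 T ×ˢ univ)) (hq : Continuous q) :
    ContinuousOn (movingMoment A w f q) (Icc 0 T) := by
  obtain ⟨C, hC⟩ := exists_moment_bound (w := w) hAb hf hq
  refine continuousOn_of_dominated (bound := fun _ => C) (fun t ht => ?_) (fun t ht => ?_) ?_ ?_
  · exact ((continuous_slice hf ht).mul hq).aestronglyMeasurable
  · exact (ae_restrict_iff' hA.measurableSet).2 (Filter.Eventually.of_forall fun y hy => hC t ht y hy)
  · exact integrableOn_const hAb.measure_lt_top.ne
  · refine Filter.Eventually.of_forall fun y => ContinuousOn.mul ?_ continuousOn_const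
    exact hf.comp (by fun_prop) fun t ht => ⟨ht, mem_univ _⟩

/-- Moments of a balance law over an isolated group. -/
lemma IsBalanceLaw.hasDerivAt_movingMoment (hl : IsBalanceLaw T ρ b a) (hA : IsOpen A)
    (hAb : Bornology.IsBounded A) {ε : ℝ} (hε : 0 < ε)
    (hvac : ∀ t ∈ Icc 0 T, ∀ y ∈ Metric.thickening ε A \ A, ρ t (y + t • w) = 0)
    (hq : ContDiff ℝ 1 q) {t : ℝ} (ht : t ∈ Ioo 0 T) :
    HasDerivAt (movingMoment A w b q)
      (∑ j, ∫ y in A, (a j (t, y + t • w) - w j * b (t, y + t • w)) * fderiv ℝ q y (basisVec j))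
      t := by
  have hmaps : MapsTo (fun z : ℝ × E3 => (z.1, z.2 + z.1 • w)) (Ioo 0 T ×ˢ univ)
      (Icc 0 T ×ˢ univ) := fun z hz => ⟨Ioo_subset_Icc_self hz.1, mem_univ _⟩
  have hsh : ∀ {g : ℝ × E3 → ℝ}, ContDiffOn ℝ 1 g (Icc 0 T ×ˢ univ) →
      ContDiffOn ℝ 1 (fun z : ℝ × E3 => g (z.1, z.2 + z.1 • w)) (Ioo 0 T ×ˢ univ) := fun hg =>
    hg.comp (contDiff_shift w).contDiffOn hmaps
  -- In the moving frame the law keeps its form with flux `a - w b`: the term `w · ∇b` from the time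
  -- derivative of the shift cancels the added flux.
  refine hasDerivAt_setIntegral_of_conservation (μ := volume)
    (b := fun z : ℝ × E3 => b (z.1, z.2 + z.1 • w))
    (a := fun j (z : ℝ × E3) => a j (z.1, z.2 + z.1 • w) - w j * b (z.1, z.2 + z.1 • w))
    (e := basisVec) (N := Metric.thickening ε A) (hsh hl.density_c1)
    (fun j => (hsh (hl.flux_c1 j)).sub (contDiffOn_const.mul (hsh hl.density_c1))) ?_ hA
    Metric.isOpen_thickening hAb.thickening (Metric.closure_subset_thickening hε A)
    ?_ ?_ hq ht
  · intro z hz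
    have hz' : (z.1, z.2 + z.1 • w) ∈ Ioo 0 T ×ˢ (univ : Set E3) := ⟨hz.1, mem_univ _⟩
    have hd : ∀ {g : ℝ × E3 → ℝ}, ContDiffOn ℝ 1 g (Icc 0 T ×ˢ univ) →
        DifferentiableAt ℝ g (z.1, z.2 + z.1 • w) := fun hg =>
      (hg.contDiffAt (IsRegularSolution.slab_mem_nhds hz')).differentiableAt one_ne_zero
    have hd' : ∀ {g : ℝ × E3 → ℝ}, ContDiffOn ℝ 1 g (Icc 0 T ×ˢ univ) →
        DifferentiableAt ℝ (fun z : ℝ × E3 => g (z.1, z.2 + z.1 • w)) z := fun hg =>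
      ((hsh hg).contDiffAt ((IsRegularSolution.isOpen_openSlab T).mem_nhds hz)).differentiableAt
        one_ne_zero
    have h1 : ∀ j, fderiv ℝ (fun z : ℝ × E3 =>
        a j (z.1, z.2 + z.1 • w) - w j * b (z.1, z.2 + z.1 • w)) z (0, basisVec j)
        = fderiv ℝ (a j) (z.1, z.2 + z.1 • w) (0, basisVec j)
          - w j * fderiv ℝ b (z.1, z.2 + z.1 • w) (0, basisVec j) := by
      intro j
      rw [fderiv_fun_sub (hd' (hl.flux_c1 j)) ((hd' hl.density_c1).const_mul _),
        fderiv_const_mul (hd' hl.density_c1)]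
      simp only [sub_apply, smul_apply, smul_eq_mul]
      rw [fderiv_comp_shift (hd (hl.flux_c1 j)), fderiv_comp_shift (hd hl.density_c1)]
      simp
    simp_rw [h1, Finset.sum_sub_distrib]
    rw [fderiv_comp_shift (hd hl.density_c1)]
    have h2 := hl.balance _ hz'
    have h3 := map_eq_time_add_sum (fderiv ℝ b (z.1, z.2 + z.1 • w)) w
    simp only [zero_add, one_smul]
    rw [h3]
    linarith
  · exact fun s hs y hy => hl.density_vacuum _ (hvac s (Ioo_subset_Icc_self hs) y hy)
  · intro j s hs y hy
    simp only
    rw [hl.density_vacuum _ (hvac s (Ioo_subset_Icc_self hs) y hy),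
      hl.flux_vacuum j _ (hvac s (Ioo_subset_Icc_self hs) y hy), mul_zero, sub_zero]

lemma IsBalanceLaw.moment_flux_eq (hl : IsBalanceLaw T ρ b a) (hAb : Bornology.IsBounded A)
    (hq : Continuous q) {t : ℝ} (ht : t ∈ Icc 0 T) (j : Fin 3) :
    ∫ y in A, (a j (t, y + t • w) - w j * b (t, y + t • w)) * q y
      = movingMoment A w (a j) q t - w j * movingMoment A w b q t := by
  have ha : IntegrableOn (fun y => a j (t, y + t • w) * q y) A := integrableOn_of_continuous hAb
    ((continuous_slice (w := w) (hl.flux_c1 j).continuousOn ht).mul hq)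
  have hb : IntegrableOn (fun y => b (t, y + t • w) * q y) A := integrableOn_of_continuous hAb
    ((continuous_slice (w := w) hl.density_c1.continuousOn ht).mul hq)
  rw [movingMoment, movingMoment, ← integral_const_mul, ← integral_sub ha (hb.const_mul _)]
  congr 1
  ext y
  ring

lemma fderiv_coord (i j : Fin 3) (y : E3) :
    fderiv ℝ (fun y : E3 => y i) y (basisVec j) = if i = j then 1 else 0 := by
  have h : HasFDerivAt (fun y : E3 => y i) (EuclideanSpace.proj i : E3 →L[ℝ] ℝ) y :=
    (EuclideanSpace.proj i : E3 →L[ℝ] ℝ).hasFDerivAt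
  rw [h.fderiv]
  simp

lemma fderiv_coord_sq (i j : Fin 3) (y : E3) :
    fderiv ℝ (fun y : E3 => y i ^ 2) y (basisVec j) = if i = j then 2 * y i else 0 := by
  have h : DifferentiableAt ℝ (fun y : E3 => y i) y :=
    (EuclideanSpace.proj i : E3 →L[ℝ] ℝ).differentiableAt
  rw [fderiv_fun_pow 2 h]
  simp only [smul_apply, fderiv_coord]
  split_ifs <;> simp

lemma contDiff_coord (i : Fin 3) : ContDiff ℝ 1 fun y : E3 => y i :=
  (EuclideanSpace.proj i : E3 →L[ℝ] ℝ).contDiff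

/-- The total amount of a conserved quantity in an isolated group is constant. -/
lemma IsBalanceLaw.movingMoment_one_eq (hl : IsBalanceLaw T ρ b a) (hA : IsOpen A)
    (hAb : Bornology.IsBounded A) {ε : ℝ} (hε : 0 < ε)
    (hvac : ∀ t ∈ Icc 0 T, ∀ y ∈ Metric.thickening ε A \ A, ρ t (y + t • w) = 0)
    {t : ℝ} (ht : t ∈ Icc 0 T) :
    movingMoment A w b (fun _ => 1) t = ∫ y in A, b (0, y) := by
  have h0 : (0 : ℝ) ∈ Icc 0 T := ⟨le_rfl, ht.1.trans ht.2⟩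
  have hcont := continuousOn_movingMoment (w := w) hAb hA hl.density_c1.continuousOn
    (continuous_const (y := (1 : ℝ)))
  have hb := norm_le_exp_mul_norm (T := T) (K := 0)
    (f := fun s => movingMoment A w b (fun _ => 1) s - movingMoment A w b (fun _ => 1) 0)
    (f' := fun _ => 0) le_rfl (hcont.sub continuousOn_const) (fun s hs => ?_)
    (fun s hs => by simp) h0 ht
  · simp only [sub_self, norm_zero, mul_zero] at hb
    rw [sub_eq_zero.1 (norm_le_zero_iff.1 hb)]
    simp [movingMoment]
  · have := hl.hasDerivAt_movingMoment hA hAb hε hvac (contDiff_const (c := (1 : ℝ))) hs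
    simpa using this.sub_const (movingMoment A w b (fun _ => 1) 0)

/-- The weight has gradient equal to the `i`-th basis vector, so only the total flux in direction
`i` survives. Applied to the energy and to the momentum, this gives the second time derivative of
the virial. -/
lemma IsBalanceLaw.hasDerivAt_movingMoment_coord (hl : IsBalanceLaw T ρ b a) (hA : IsOpen A)
    (hAb : Bornology.IsBounded A) {ε : ℝ} (hε : 0 < ε)
    (hvac : ∀ t ∈ Icc 0 T, ∀ y ∈ Metric.thickening ε A \ A, ρ t (y + t • w) = 0)
    (i : Fin 3) {t : ℝ} (ht : t ∈ Ioo 0 T) :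
    HasDerivAt (movingMoment A w b fun y => y i)
      (movingMoment A w (a i) (fun _ => 1) t - w i * movingMoment A w b (fun _ => 1) t) t := by
  refine (hl.hasDerivAt_movingMoment hA hAb hε hvac (contDiff_coord i) ht).congr_deriv ?_
  rw [← hl.moment_flux_eq hAb continuous_const (Ioo_subset_Icc_self ht),
    Finset.sum_eq_single i]
  · simp only [fderiv_coord, if_true]
  · intro j _ hj
    simp [fderiv_coord, hj.symm]
  · simp

lemma IsBalanceLaw.hasDerivAt_movingMoment_coord_sq (hl : IsBalanceLaw T ρ b a) (hA : IsOpen A)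
    (hAb : Bornology.IsBounded A) {ε : ℝ} (hε : 0 < ε)
    (hvac : ∀ t ∈ Icc 0 T, ∀ y ∈ Metric.thickening ε A \ A, ρ t (y + t • w) = 0)
    (i : Fin 3) {t : ℝ} (ht : t ∈ Ioo 0 T) :
    HasDerivAt (movingMoment A w b fun y => y i ^ 2)
      (2 * (movingMoment A w (a i) (fun y => y i) t
        - w i * movingMoment A w b (fun y => y i) t)) t := by
  refine (hl.hasDerivAt_movingMoment hA hAb hε hvac ((contDiff_coord i).pow 2) ht).congr_deriv ?_
  rw [← hl.moment_flux_eq hAb (contDiff_coord i).continuous (Ioo_subset_Icc_self ht),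
    Finset.sum_eq_single i, ← integral_const_mul]
  · simp only [fderiv_coord_sq, if_true]
    congr 1
    ext y
    ring
  · intro j _ hj
    simp [fderiv_coord_sq, hj.symm]
  · simp

end Moments

/-! ### The virial inequality and the bound on the life span -/

/-- A bounded function whose second derivative is bounded below by `δ > 0` lives only on a short
interval. -/
lemma mul_sq_le_of_second_deriv_ge {T δ B : ℝ} {N V W : ℝ → ℝ} (hT : 0 < T)
    (hN : ∀ t ∈ Ioo 0 T, HasDerivAt N (V t) t) (hV : ∀ t ∈ Ioo 0 T, HasDerivAt V (W t) t)
    (hW : ∀ t ∈ Ioo 0 T, δ ≤ W t) (h0 : ∀ t ∈ Ioo 0 T, 0 ≤ N t) (hB : ∀ t ∈ Ioo 0 T, N t ≤ B) :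
    δ * T ^ 2 ≤ 32 * B := by
  have hd1 : ∀ t ∈ Ioo 0 T, HasDerivAt (fun t => N t - δ / 2 * t ^ 2) (V t - δ * t) t := by
    intro t ht
    refine ((hN t ht).sub ((hasDerivAt_pow 2 t).const_mul (δ / 2))).congr_deriv ?_
    simp
    ring
  have hd2 : ∀ t ∈ Ioo 0 T, HasDerivAt (fun t => V t - δ * t) (W t - δ) t := by
    intro t ht
    refine ((hV t ht).sub ((hasDerivAt_id t).const_mul δ)).congr_deriv ?_
    simp
  have hconv : ConvexOn ℝ (Ioo 0 T) fun t => N t - δ / 2 * t ^ 2 := by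
    refine convexOn_of_hasDerivWithinAt2_nonneg (convex_Ioo 0 T)
      (fun t ht => (hd1 t ht).continuousAt.continuousWithinAt) (f' := fun t => V t - δ * t)
      (f'' := fun t => W t - δ) ?_ ?_ ?_
    all_goals rw [interior_Ioo]
    · exact fun t ht => (hd1 t ht).hasDerivWithinAt
    · exact fun t ht => (hd2 t ht).hasDerivWithinAt
    · exact fun t ht => sub_nonneg.2 (hW t ht)
  -- Interior points suffice, so nothing is needed at the endpoints. In the midpoint inequality the
  -- quadratic term contributes `(δ / 2) (5/16 - 1/4) T² = δ T² / 32`, whence the constant.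
  have m1 : T / 4 ∈ Ioo 0 T := ⟨by linarith, by linarith⟩
  have m2 : T / 2 ∈ Ioo 0 T := ⟨by linarith, by linarith⟩
  have m3 : 3 * T / 4 ∈ Ioo 0 T := ⟨by linarith, by linarith⟩
  have key := hconv.2 m1 m3 (by norm_num : (0 : ℝ) ≤ 1 / 2) (by norm_num : (0 : ℝ) ≤ 1 / 2)
    (by norm_num)
  simp only [smul_eq_mul] at key
  rw [show 1 / 2 * (T / 4) + 1 / 2 * (3 * T / 4) = T / 2 by ring] at key
  have := h0 _ m2
  have := hB _ m1
  have := hB _ m3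
  nlinarith

/-- Lower bound for the trace of the momentum flux by the energy density. -/
lemma mul_rhoHat_sub_le {c k γ r l : ℝ} {v : E3} (hγ : 1 ≤ γ) (hr : 0 ≤ r) (hv : ‖v‖ < c)
    (hl : 0 < l) :
    min (c ^ 2) (k ^ 2 * l ^ (γ - 1)) * (rhoHat c k γ r v - l)
      ≤ rhoTilde c k γ r v * ‖v‖ ^ 2 + 3 * pressure k γ r := by
  have hc : 0 < c := (norm_nonneg v).trans_lt hv
  set μ := min (c ^ 2) (k ^ 2 * l ^ (γ - 1)) with hμ
  have hμ0 : 0 ≤ μ := le_min (by positivity) (by positivity)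
  have hkin : μ * (rhoTilde c k γ r v * ‖v‖ ^ 2 / c ^ 2) ≤ rhoTilde c k γ r v * ‖v‖ ^ 2 := by
    have h1 : 0 ≤ rhoTilde c k γ r v * ‖v‖ ^ 2 / c ^ 2 :=
      div_nonneg (mul_nonneg (rhoTilde_nonneg hv hr) (by positivity)) (by positivity)
    refine (mul_le_mul_of_nonneg_right (min_le_left _ _) h1).trans_eq ?_
    field_simp
  -- Below the threshold `l` the left side is nonpositive; above it, `P / r = k² r^(γ-1)` is at
  -- least its value at `l`. The threshold is needed because `P / r` may tend to zero at vacuum.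
  have hpr : μ * (r - l) ≤ pressure k γ r := by
    rcases le_total r l with h | h
    · exact (mul_nonpos_of_nonneg_of_nonpos hμ0 (by linarith)).trans (pressure_nonneg hr)
    · rw [pressure_eq_mul hγ hr]
      have h1 : μ ≤ k ^ 2 * r ^ (γ - 1) := (min_le_right _ _).trans
        (mul_le_mul_of_nonneg_left (Real.rpow_le_rpow hl.le h (by linarith)) (by positivity))
      nlinarith
  rw [rhoHat_eq_add hv]
  have := pressure_nonneg (k := k) (γ := γ) hr
  linarith

namespace IsRegularSolution

variable {c k γ T : ℝ} {ρ₀ : E3 → ℝ} {u₀ : E3 → E3} {ρ : ℝ → E3 → ℝ} {u : ℝ → E3 → E3}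

/-- The energy flux is the momentum density. This is why differentiating a second moment of the
energy twice leads to the trace of the momentum flux. -/
lemma isBalanceLaw_energy (h : IsRegularSolution c k γ ρ₀ u₀ T ρ u) (hγ : 1 ≤ γ) :
    IsBalanceLaw T ρ (fun z => rhoHat c k γ (ρ z.1 z.2) (u z.1 z.2))
      (fun j z => rhoTilde c k γ (ρ z.1 z.2) (u z.1 z.2) * u z.1 z.2 j) where
  density_c1 := h.contDiffOn_rhoHat hγ
  flux_c1 := h.contDiffOn_momentum hγ
  balance _ hz := h.energy_eq hγ hz
  density_vacuum z hz := by rw [hz, rhoHat_zero hγ]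
  flux_vacuum j z hz := by rw [hz, rhoTilde_zero hγ, zero_mul]

lemma isBalanceLaw_momentum (h : IsRegularSolution c k γ ρ₀ u₀ T ρ u) (hγ : 1 ≤ γ) (i : Fin 3) :
    IsBalanceLaw T ρ (fun z => rhoTilde c k γ (ρ z.1 z.2) (u z.1 z.2) * u z.1 z.2 i)
      (fun j z => rhoTilde c k γ (ρ z.1 z.2) (u z.1 z.2) * u z.1 z.2 i * u z.1 z.2 j
        + if j = i then pressure k γ (ρ z.1 z.2) else 0) where
  density_c1 := h.contDiffOn_momentum hγ i
  flux_c1 := h.contDiffOn_momentumFlux hγ i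
  balance _ hz := h.momentum_eq hγ i hz
  density_vacuum z hz := by rw [hz, rhoTilde_zero hγ, zero_mul]
  flux_vacuum j z hz := by rw [hz, rhoTilde_zero hγ, pressure_zero hγ]; simp

/-- The virial argument: the life span of a regular solution is controlled by the data. -/
lemma mul_sq_time_le (h : IsRegularSolution c k γ ρ₀ u₀ T ρ u) (hγ : 1 ≤ γ)
    {A₀ B₀ : Set E3} (hAB : IsIsolatedMassGroup c k γ ρ₀ u₀ A₀ B₀) {R l : ℝ}
    (hBR : B₀ ⊆ Metric.ball 0 R) (hl : 0 < l) :
    2 * min (c ^ 2) (k ^ 2 * l ^ (γ - 1))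
        * ((∫ y in A₀, rhoHat c k γ (ρ₀ y) (u₀ y)) - l * (volume A₀).toReal) * T ^ 2
      ≤ 32 * (R ^ 2 * ∫ y in A₀, rhoHat c k γ (ρ₀ y) (u₀ y)) := by
  obtain ⟨w, hw⟩ := hAB.velocity_const
  obtain ⟨ε, hε, hvac⟩ := h.exists_vacuum_annulus hγ hAB hw
  set μ := min (c ^ 2) (k ^ 2 * l ^ (γ - 1)) with hμ
  set E := ∫ y in A₀, rhoHat c k γ (ρ₀ y) (u₀ y) with hE
  have hA := hAB.isOpen_A
  have hAR : A₀ ⊆ Metric.ball 0 R := subset_closure.trans (hAB.closure_subset.trans hBR)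
  have hAb : Bornology.IsBounded A₀ := Metric.isBounded_ball.subset hAR
  have hen := h.isBalanceLaw_energy hγ
  have hmo := h.isBalanceLaw_momentum hγ
  set H : ℝ × E3 → ℝ := fun z => rhoHat c k γ (ρ z.1 z.2) (u z.1 z.2) with hH
  set m : Fin 3 → ℝ × E3 → ℝ :=
    fun j z => rhoTilde c k γ (ρ z.1 z.2) (u z.1 z.2) * u z.1 z.2 j with hm
  set F : Fin 3 → Fin 3 → ℝ × E3 → ℝ := fun i j z =>
    rhoTilde c k γ (ρ z.1 z.2) (u z.1 z.2) * u z.1 z.2 i * u z.1 z.2 j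
      + if j = i then pressure k γ (ρ z.1 z.2) else 0 with hF
  have hEt : ∀ t ∈ Icc 0 T, movingMoment A₀ w H (fun _ => 1) t = E := by
    intro t ht
    rw [hen.movingMoment_one_eq hA hAb hε hvac ht, hE]
    simp [hH, h.init_density, h.init_velocity]
  have h0T : (0 : ℝ) ∈ Icc 0 T := left_mem_Icc.2 h.pos_time.le
  have hmt : ∀ i, ∀ t ∈ Icc 0 T, movingMoment A₀ w (m i) (fun _ => 1) t = 0 := by
    intro i t ht
    rw [(hmo i).movingMoment_one_eq hA hAb hε hvac ht]
    have hint : IntegrableOn (fun y => rhoTilde c k γ (ρ₀ y) (u₀ y) • u₀ y) A₀ := by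
      have h1 : Continuous fun y => rhoTilde c k γ (ρ 0 y) (u 0 y) • u 0 y :=
        ((h.contDiffOn_rhoTilde hγ).continuousOn.smul h.velocity_c1.continuousOn).comp_continuous
          (f := fun y : E3 => ((0 : ℝ), y)) (by fun_prop) fun y => ⟨h0T, mem_univ _⟩
      simp only [h.init_density, h.init_velocity] at h1
      exact (h1.continuousOn.integrableOn_compact hAb.isCompact_closure).mono_set subset_closure
    have h2 := (EuclideanSpace.proj i : E3 →L[ℝ] ℝ).integral_comp_comm hint
    rw [hAB.momentum_zero, map_zero] at h2
    simpa [hm, h.init_density, h.init_velocity] using h2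
  have hpt : ∀ t ∈ Icc 0 T, ∀ y, 0 ≤ H (t, y) := by
    intro t ht y
    have hv := h.subluminal t ht y
    have hr := h.density_nonneg t ht y
    simp only [hH]
    rw [rhoHat_eq_add hv]
    exact add_nonneg hr (div_nonneg (mul_nonneg (rhoTilde_nonneg hv hr) (by positivity))
      (by positivity))
  have hintH : ∀ {q : E3 → ℝ}, Continuous q → ∀ t ∈ Icc 0 T,
      IntegrableOn (fun y => H (t, y + t • w) * q y) A₀ := fun hq t ht =>
    integrableOn_of_continuous hAb ((continuous_slice hen.density_c1.continuousOn ht).mul hq)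
  have hNeq : ∀ t ∈ Icc 0 T, ∑ i, movingMoment A₀ w H (fun y => y i ^ 2) t
      = ∫ y in A₀, H (t, y + t • w) * ‖y‖ ^ 2 := by
    intro t ht
    simp only [movingMoment]
    rw [← integral_finsetSum _ fun i _ =>
      hintH (((contDiff_coord i).pow 2).continuous) t ht]
    simp_rw [norm_sq_eq_sum, Finset.mul_sum]
  refine mul_sq_le_of_second_deriv_ge h.pos_time
    (N := fun t => ∑ i, movingMoment A₀ w H (fun y => y i ^ 2) t)
    (V := fun t => ∑ i, 2 * (movingMoment A₀ w (m i) (fun y => y i) t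
        - w i * movingMoment A₀ w H (fun y => y i) t))
    (W := fun t => ∑ i, 2 * ((movingMoment A₀ w (F i i) (fun _ => 1) t
        - w i * movingMoment A₀ w (m i) (fun _ => 1) t)
        - w i * (movingMoment A₀ w (m i) (fun _ => 1) t
          - w i * movingMoment A₀ w H (fun _ => 1) t))) ?_ ?_ ?_ ?_ ?_
  · exact fun t ht => HasDerivAt.fun_sum fun i _ =>
      hen.hasDerivAt_movingMoment_coord_sq hA hAb hε hvac i ht
  · exact fun t ht => HasDerivAt.fun_sum fun i _ =>
      (((hmo i).hasDerivAt_movingMoment_coord hA hAb hε hvac i ht).sub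
        ((hen.hasDerivAt_movingMoment_coord hA hAb hε hvac i ht).const_mul (w i))).const_mul 2
  · intro t ht
    have ht' := Ioo_subset_Icc_self ht
    -- Vanishing momentum removes the cross terms of indefinite sign; what is left is twice the
    -- trace of the flux plus `2 |w|² E`, whose sign is favourable.
    simp only [hmt _ t ht', hEt t ht', mul_zero, sub_zero, zero_sub]
    have hE0 : 0 ≤ E := by
      rw [← hEt t ht', movingMoment]
      exact setIntegral_nonneg hA.measurableSet fun y _ => by simpa using hpt t ht' _
    have hFint : ∀ i, IntegrableOn (fun y => F i i (t, y + t • w) * 1) A₀ := fun i =>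
      integrableOn_of_continuous hAb
        ((continuous_slice ((hmo i).flux_c1 i).continuousOn ht').mul continuous_const)
    have hsum : ∑ i, movingMoment A₀ w (F i i) (fun _ => 1) t
        = ∫ y in A₀, ∑ i, F i i (t, y + t • w) * 1 := by
      simp only [movingMoment]
      rw [integral_finsetSum _ fun i _ => hFint i]
    have hHint : IntegrableOn (fun y => H (t, y + t • w)) A₀ := by
      simpa using hintH (continuous_const (y := (1 : ℝ))) t ht'
    have hlint : IntegrableOn (fun _ : E3 => l) A₀ := integrableOn_const hAb.measure_lt_top.ne
    -- The trace of the momentum flux is `ρ̃ |u|² + 3P`, so the pointwise bound integrates against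
    -- the conserved energy.
    have hlow : μ * (E - l * (volume A₀).toReal)
        ≤ ∑ i, movingMoment A₀ w (F i i) (fun _ => 1) t := by
      have h1 : μ * (E - l * (volume A₀).toReal) = ∫ y in A₀, μ * (H (t, y + t • w) - l) := by
        rw [integral_const_mul, integral_sub hHint hlint, ← hEt t ht', movingMoment]
        simp [Measure.real, mul_comm]
      rw [h1, hsum]
      refine setIntegral_mono ((hHint.sub hlint).const_mul _)
        (integrable_finsetSum _ fun i _ => hFint i) fun y => ?_
      have h2 := mul_rhoHat_sub_le (k := k) hγ (h.density_nonneg t ht' (y + t • w))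
        (h.subluminal t ht' (y + t • w)) hl
      refine h2.trans_eq ?_
      rw [norm_sq_eq_sum]
      simp [hF, Fin.sum_univ_three]
      ring
    have hnn : 0 ≤ ∑ i, 2 * (w i * (w i * E)) := Finset.sum_nonneg fun i _ => by
      nlinarith [mul_nonneg (mul_self_nonneg (w i)) hE0]
    calc 2 * μ * (E - l * (volume A₀).toReal)
        ≤ 2 * ∑ i, movingMoment A₀ w (F i i) (fun _ => 1) t + ∑ i, 2 * (w i * (w i * E)) := by
          linarith
      _ = _ := by
          rw [Finset.mul_sum, ← Finset.sum_add_distrib]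
          exact Finset.sum_congr rfl fun i _ => by ring
  · intro t ht
    simp only
    rw [hNeq t (Ioo_subset_Icc_self ht)]
    exact setIntegral_nonneg hA.measurableSet fun y _ =>
      mul_nonneg (hpt t (Ioo_subset_Icc_self ht) _) (by positivity)
  · intro t ht
    have ht' := Ioo_subset_Icc_self ht
    simp only
    rw [hNeq t ht', ← hEt t ht', movingMoment, ← integral_const_mul]
    refine setIntegral_mono_on (hintH (by fun_prop) t ht')
      ((hintH continuous_const t ht').const_mul _) hA.measurableSet fun y hy => ?_
    have hyR := (mem_ball_zero_iff.1 (hAR hy)).le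
    have h1 : ‖y‖ ^ 2 ≤ R ^ 2 := pow_le_pow_left₀ (norm_nonneg y) hyR 2
    nlinarith [hpt t ht' (y + t • w)]

/-- The energy of the group is positive. -/
lemma energy_pos (h : IsRegularSolution c k γ ρ₀ u₀ T ρ u) (hγ : 1 ≤ γ)
    {A₀ B₀ : Set E3} (hAB : IsIsolatedMassGroup c k γ ρ₀ u₀ A₀ B₀) :
    0 < ∫ y in A₀, rhoHat c k γ (ρ₀ y) (u₀ y) := by
  have h0T : (0 : ℝ) ∈ Icc 0 T := left_mem_Icc.2 h.pos_time.le
  obtain ⟨R, -, hBR⟩ := hAB.bounded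
  have hAb : Bornology.IsBounded A₀ :=
    Metric.isBounded_ball.subset (subset_closure.trans (hAB.closure_subset.trans hBR))
  have hc1 : Continuous ρ₀ := by
    have := continuous_slice (w := 0) h.density_c1.continuousOn h0T
    simpa [h.init_density] using this
  have hc2 : Continuous fun y => rhoHat c k γ (ρ₀ y) (u₀ y) := by
    have := continuous_slice (w := 0) (h.contDiffOn_rhoHat hγ).continuousOn h0T
    simpa [h.init_density, h.init_velocity] using this
  refine hAB.mass_pos.trans_le (setIntegral_mono (integrableOn_of_continuous hAb hc1)
    (integrableOn_of_continuous hAb hc2) fun y => ?_)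
  have hv := h.subluminal 0 h0T y
  have hr := h.density_nonneg 0 h0T y
  rw [h.init_velocity] at hv
  rw [h.init_density] at hr
  simp only
  rw [rhoHat_eq_add hv]
  exact le_add_of_nonneg_right (div_nonneg (mul_nonneg (rhoTilde_nonneg hv hr) (by positivity))
    (by positivity))

end IsRegularSolution

end RelEuler
end

/-! ### Conclusion: choice of the threshold and finiteness of the maximal time -/

theorem mainTheorem3 (c k γ : ℝ) (hc : 0 < c) (hk : 0 < k) (hγ : 1 ≤ γ)
    (ρ₀ : RelEuler.E3 → ℝ) (u₀ : RelEuler.E3 → RelEuler.E3) (A₀ B₀ : Set RelEuler.E3)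
    (hAB : RelEuler.IsIsolatedMassGroup c k γ ρ₀ u₀ A₀ B₀) :
    RelEuler.maximalTime c k γ ρ₀ u₀ < ⊤ := by
  obtain ⟨R, hR, hBR⟩ := hAB.bounded
  set E := ∫ y in A₀, RelEuler.rhoHat c k γ (ρ₀ y) (u₀ y) with hE
  set vol := (MeasureTheory.volume A₀).toReal with hvol
  -- With this threshold `E - l vol = E / 2`: half of the energy still drives the convexity.
  set l := E / (2 * vol) with hl
  set μ := min (c ^ 2) (k ^ 2 * l ^ (γ - 1)) with hμ
  have hvol0 : 0 < vol := by
    have hfin : MeasureTheory.volume A₀ ≠ ⊤ := (Metric.isBounded_ball.subset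
      (subset_closure.trans (hAB.closure_subset.trans hBR))).measure_lt_top.ne
    refine ENNReal.toReal_pos (fun h0 => ?_) hfin
    have := hAB.mass_pos
    rw [MeasureTheory.setIntegral_measure_zero _ h0] at this
    exact lt_irrefl _ this
  -- Positivity of `E` is obtained from a solution, whose existence makes the data continuous and
  -- subluminal. If there is none, the supremum runs over the empty set.
  have hbound : ∀ T ρ u, RelEuler.IsRegularSolution c k γ ρ₀ u₀ T ρ u →
      T ≤ Real.sqrt (32 * R ^ 2 / μ) := by
    intro T ρ u h
    have hE0 : 0 < E := h.energy_pos hγ hAB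
    have hl0 : 0 < l := by positivity
    have hμ0 : 0 < μ := lt_min (by positivity) (by positivity)
    have key := h.mul_sq_time_le hγ hAB hBR hl0
    rw [← hE, ← hvol, ← hμ, show E - l * vol = E / 2 by rw [hl]; field_simp; ring] at key
    refine Real.le_sqrt_of_sq_le ?_
    rw [le_div_iff₀ hμ0]
    nlinarith
  refine lt_of_le_of_lt (sSup_le ?_) (ENNReal.ofReal_lt_top (r := Real.sqrt (32 * R ^ 2 / μ)))
  rintro _ ⟨T, rfl, ρ, u, h⟩
  exact ENNReal.ofReal_le_ofReal (hbound T ρ u h)
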